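/- For $n\ge 1$ let $\sigma$ be a uniformly random permutation of $\{1,\dots,n\}$. Start with the string of $n$ zeros and change the zeros at the places $\sigma(1),\sigma(2),\dots,\sigma(n)$ to ones, one at a time and in this order. For $0\le m\le n$ let $X_{n,m}$ be the number of runs of 1's (maximal nonempty blocks of consecutive 1's) in the string after $m$ changes, and let $X^*_n=\max_{0\le m\le n}X_{n,m}$. Then, as $n\to\infty$, $$n^{-1/2}\bigl(X^*_n-n/4\bigr)\to N(0,1/16)\quad\text{in distribution},$$ with convergence of all moments: with $Y_n=n^{-1/2}(X^*_n-n/4)$ and $Y\sim N(0,1/16)$, we have $\mathbb E\,Y_n^r\to\mathbb E\,Y^r$ for every integer $r\ge 0$ and $\mathbb E\,|Y_n|^r\to\mathbb E\,|Y|^r$ for every real $r>0$. In particular, $$\mathbb E X^*_n=n/4+o(n^{1/2}),\qquad \operatorname{Var}X^*_n=n/16+o(n),$$ and hence the constant $\gamma=\lim_{n\to\infty}\mathbb E X^*_n/n$ exists and equals $1/4$. -/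

import Mathlib

open MeasureTheory ProbabilityTheory Filter Topology Asymptotics
open scoped NNReal ENNReal

/-- The block of places `i, …, j` is a run of 1's of the string `s`: it is nonempty, consists of
1's only, and is maximal, i.e. the place just before `i` and the place just after `j` (if there
is one) holds a 0. -/
def IsRun {n : ℕ} (s : Fin n → Bool) (i j : Fin n) : Prop :=
  i ≤ j ∧ (∀ k, i ≤ k → k ≤ j → s k = true) ∧
    (∀ k : Fin n, (k : ℕ) + 1 = i → s k = false) ∧
    (∀ k : Fin n, (k : ℕ) = j + 1 → s k = false)

instance {n : ℕ} (s : Fin n → Bool) (i j : Fin n) : Decidable (IsRun s i j) := by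
  unfold IsRun; infer_instance

/-- The number of runs of 1's in the string `s`. -/
def runCount {n : ℕ} (s : Fin n → Bool) : ℕ :=
  (Finset.univ.filter fun p : Fin n × Fin n => IsRun s p.1 p.2).card

/-- The string after `m` steps, when the places of the 0-string of length `n` are changed to 1 in
the order `σ 0, σ 1, …, σ (n - 1)`: the place `k` holds a 1 iff it is among the `m` first ones. -/
def stringAt {n : ℕ} (σ : Equiv.Perm (Fin n)) (m : ℕ) : Fin n → Bool :=
  fun k => decide ((σ.symm k : ℕ) < m)

/-- The maximum over `0 ≤ m ≤ n` of the number of runs of 1's after `m` steps. -/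
def maxRuns {n : ℕ} (σ : Equiv.Perm (Fin n)) : ℕ :=
  (Finset.range (n + 1)).sup fun m => runCount (stringAt σ m)

/-- `σ` is a uniformly distributed random permutation of `n` items, defined on the
space `Ω` with the measure `P`. -/
def IsUniformPerm {Ω : Type*} [MeasurableSpace Ω] {n : ℕ} (σ : Ω → Equiv.Perm (Fin n))
    (P : Measure Ω) : Prop :=
  ∀ π : Equiv.Perm (Fin n), MeasurableSet {ω | σ ω = π} ∧
    P {ω | σ ω = π} = ((n.factorial : ℝ≥0∞))⁻¹

/-- The normalized maximum `n^{-1/2} (X*_n - n/4)`. -/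
noncomputable def normMaxRuns {n : ℕ} (σ : Equiv.Perm (Fin n)) : ℝ :=
  (√(n : ℝ))⁻¹ * ((maxRuns σ : ℝ) - (n : ℝ) / 4)

/-! A uniform permutation can be realized as `Tuple.sort U`, where the coordinates of `U` are
independent and uniform on [0,1]. Almost surely there are no ties, and the string after m steps then
holds a 1 exactly where `U` is at most its m-th smallest value. So X* is the maximum over levels x
of R(x), the number of runs in the string marking the places with U_k ≤ x.

Up to a boundary term, R(x) counts the k with U_{k+1} ≤ x < U_k. Its mean is about n x(1-x), which
peaks at n/4 for x = 1/2. At distance d from 1/2 each term loses d² in mean, while its difference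
from the term at 1/2 has second moment at most 2d. The drift n d² beats the fluctuation √(n d) once
d exceeds n^(-1/3), so X* should exceed R(1/2) by no more than n^(1/3), up to a logarithm.
`lintegral_exp_ascentInd_le` turns this into an exponential moment bound uniform in x,
`lintegral_exp_levelRuns_self_le` carries it to the random level U_j, and a sum over j gives
`lintegral_exp_excess_le`. Divided by √n, the excess vanishes in the limit.

At x = 1/2 the string consists of fair bits. Twice its run count is, up to 1, the number of changes
of value, and the changes are themselves independent fair bits. Hence R(1/2) - n/4 is, up to 1/2, a
quarter of a sum of n independent signs, whose transforms are powers of cosh and cos. Lévy's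
continuity theorem gives the limit N(0, 1/16), and a uniform exponential moment
(`exists_integral_exp_abs_normMaxRuns_le`) upgrades it to convergence of moments. -/

/-! ### Runs counted by their left ends -/

/-- A place is the left end of a run of 1's. -/
lemma exists_isRun_iff {n : ℕ} (s : Fin n → Bool) (i : Fin n) :
    (∃ j, IsRun s i j) ↔ s i = true ∧ ∀ k : Fin n, (k : ℕ) + 1 = i → s k = false := by
  constructor
  · rintro ⟨j, hij, h1, h2, -⟩
    exact ⟨h1 i le_rfl hij, h2⟩
  · rintro ⟨hi, h2⟩
    let A : Finset (Fin n) := Finset.univ.filter fun j => i ≤ j ∧ ∀ k, i ≤ k → k ≤ j → s k = true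
    have hA : A.Nonempty := ⟨i, by
      simp only [A, Finset.mem_filter, Finset.mem_univ, true_and, le_refl]
      intro k hk hk'
      rwa [le_antisymm hk' hk]⟩
    have hm := A.max'_mem hA
    set j := A.max' hA with hj
    simp only [A, Finset.mem_filter, Finset.mem_univ, true_and] at hm
    refine ⟨j, hm.1, hm.2, h2, fun k hk => ?_⟩
    by_contra hs
    have hs : s k = true := by simpa using hs
    have : k ∈ A := by
      simp only [A, Finset.mem_filter, Finset.mem_univ, true_and]
      refine ⟨hm.1.trans (Fin.le_def.2 (by omega)), fun l hl hl' => ?_⟩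
      rcases eq_or_lt_of_le hl' with h | h
      · rwa [h]
      · exact hm.2 l hl (Fin.le_def.2 (by have := Fin.lt_def.1 h; omega))
    have := Fin.le_def.1 (A.le_max' k this)
    rw [← hj] at this
    omega

lemma IsRun.right_unique {n : ℕ} {s : Fin n → Bool} {i j j' : Fin n} (h : IsRun s i j)
    (h' : IsRun s i j') : j = j' := by
  have key : ∀ {j j' : Fin n}, IsRun s i j → IsRun s i j' → ¬ j < j' := by
    intro j j' h h' hlt
    have hlt' := Fin.lt_def.1 hlt
    have h1 := h.2.2.2 ⟨j + 1, by omega⟩ rfl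
    have h2 := h'.2.1 ⟨j + 1, by omega⟩ (h.1.trans (Fin.le_def.2 (by simp)))
      (Fin.le_def.2 (by simpa using hlt'))
    simp [h1] at h2
  exact le_antisymm (not_lt.1 (key h' h)) (not_lt.1 (key h h'))

lemma runCount_eq_card_leftEnds {n : ℕ} (s : Fin n → Bool) :
    runCount s = (Finset.univ.filter fun i : Fin n =>
      s i = true ∧ ∀ k : Fin n, (k : ℕ) + 1 = i → s k = false).card := by
  rw [runCount]
  refine Finset.card_bij (fun p _ => p.1) ?_ ?_ ?_
  · intro p hp
    simp only [Finset.mem_filter, Finset.mem_univ, true_and] at hp ⊢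
    exact (exists_isRun_iff s p.1).1 ⟨p.2, hp⟩
  · rintro ⟨i, j⟩ hp ⟨i', j'⟩ hq (rfl : i = i')
    simp only [Finset.mem_filter, Finset.mem_univ, true_and] at hp hq
    rw [hp.right_unique hq]
  · intro i hi
    simp only [Finset.mem_filter, Finset.mem_univ, true_and] at hi
    obtain ⟨j, hj⟩ := (exists_isRun_iff s i).2 hi
    exact ⟨(i, j), by simpa using hj, rfl⟩

lemma runCount_succ {m : ℕ} (s : Fin (m + 1) → Bool) :
    runCount s = (if s 0 = true then 1 else 0) +
      ∑ k : Fin m, if s k.castSucc = false ∧ s k.succ = true then 1 else 0 := by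
  rw [runCount_eq_card_leftEnds, Finset.card_filter, Fin.sum_univ_succ]
  congr 1
  · simp
  · refine Finset.sum_congr rfl fun k _ => ?_
    congr 1
    rw [eq_iff_iff, and_comm]
    refine and_congr_left fun _ => ⟨fun h => h _ (by simp), fun h l hl => ?_⟩
    have : l = k.castSucc := Fin.ext (by simpa using hl)
    rwa [this]

lemma runCount_zero (s : Fin 0 → Bool) : runCount s = 0 := by
  simp [runCount]

lemma runCount_of_eq_false {n : ℕ} {s : Fin n → Bool} (h : ∀ k, s k = false) :
    runCount s = 0 := by
  simp [runCount_eq_card_leftEnds, h]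

lemma runCount_le {n : ℕ} (s : Fin n → Bool) : runCount s ≤ n := by
  rw [runCount_eq_card_leftEnds]
  exact (Finset.card_le_univ _).trans (by simp)

/-- Changing a string at one place changes the number of runs by at most 2. -/
lemma runCount_le_add_two {n : ℕ} {s t : Fin n → Bool} (a : Fin n)
    (h : ∀ k, k ≠ a → s k = t k) : runCount s ≤ runCount t + 2 := by
  classical
  simp only [runCount_eq_card_leftEnds]
  set T := Finset.univ.filter fun i : Fin n =>
      t i = true ∧ ∀ k : Fin n, (k : ℕ) + 1 = i → t k = false
  let B : Finset (Fin n) := Finset.univ.filter fun k => (k : ℕ) = a + 1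
  have hB : B.card ≤ 1 := Finset.card_le_one.2 fun x hx y hy => by
    simp only [B, Finset.mem_filter, Finset.mem_univ, true_and] at hx hy
    exact Fin.ext (hx.trans hy.symm)
  refine (Finset.card_le_card (t := T ∪ (insert a B)) fun i hi => ?_).trans
    ((Finset.card_union_le _ _).trans ?_)
  · simp only [Finset.mem_filter, Finset.mem_univ, true_and, Finset.mem_union, Finset.mem_insert,
      T, B] at hi ⊢
    by_cases hia : i = a
    · simp [hia]
    by_cases hib : (i : ℕ) = a + 1
    · simp [hib]
    refine Or.inl ⟨by rw [← h i hia]; exact hi.1, fun k hk => ?_⟩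
    have hka : k ≠ a := by
      rintro rfl
      exact hib hk.symm
    rw [← h k hka]
    exact hi.2 k hk
  · have := Finset.card_insert_le a B
    omega

/-! ### Changes of value, ascents and runs -/

/-- The number of changes of value along the string `p, s 0, s 1, …`. -/
def changes : {n : ℕ} → Bool → (Fin n → Bool) → ℕ
  | 0, _, _ => 0
  | _ + 1, p, s => (if p = s 0 then 0 else 1) + changes (s 0) (Fin.tail s)

/-- The number of ascents along the string `p, s 0, s 1, …`. -/
def ascents : {n : ℕ} → Bool → (Fin n → Bool) → ℕ
  | 0, _, _ => 0
  | _ + 1, p, s => (if p = false ∧ s 0 = true then 1 else 0) + ascents (s 0) (Fin.tail s)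

/-- Ascents and descents alternate, so their numbers differ by at most one. The term in `p` records
which of the two comes first; with it the induction can pass to the tail, whose initial value is `s
0`. -/
lemma changes_le {n : ℕ} (p : Bool) (s : Fin n → Bool) :
    changes p s ≤ 2 * ascents p s + (if p = true then 1 else 0) ∧
      2 * ascents p s + (if p = true then 1 else 0) ≤ changes p s + 1 := by
  induction n generalizing p with
  | zero => cases p <;> simp [changes, ascents]
  | succ n ih =>
    have := ih (s 0) (Fin.tail s)
    clear ih
    rw [changes, ascents]
    cases p <;> cases h : s 0 <;> simp_all <;> omega

lemma ascents_succ {m : ℕ} (p : Bool) (s : Fin (m + 1) → Bool) :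
    ascents p s = (if p = false ∧ s 0 = true then 1 else 0) +
      ∑ k : Fin m, if s k.castSucc = false ∧ s k.succ = true then 1 else 0 := by
  induction m generalizing p with
  | zero => simp [ascents]
  | succ m ih =>
    rw [ascents, ih, Fin.sum_univ_succ]
    simp [Fin.tail, -Finset.sum_boole]
    rfl

lemma ascents_eq_runCount {n : ℕ} (s : Fin n → Bool) : ascents false s = runCount s := by
  cases n with
  | zero => simp [ascents, runCount_zero]
  | succ m => simp [ascents_succ, runCount_succ]

lemma abs_two_mul_runCount_sub_changes {n : ℕ} (s : Fin n → Bool) :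
    |2 * (runCount s : ℝ) - changes false s| ≤ 1 := by
  have h := changes_le false s
  rw [ascents_eq_runCount] at h
  simp only [Bool.false_eq_true, if_false, add_zero] at h
  rw [abs_le]
  have h1 : (changes false s : ℝ) ≤ 2 * runCount s := by exact_mod_cast h.1
  have h2 : 2 * (runCount s : ℝ) ≤ changes false s + 1 := by exact_mod_cast h.2
  constructor <;> linarith

/-- For fixed `p`, a string and the record of where it changes determine each other, so the number
of changes of a fair string is binomial. A general semiring lets `z` be real (Laplace transform) or
complex (Fourier transform). -/
lemma sum_pow_changes {R : Type*} [CommSemiring R] (z : R) (n : ℕ) (p : Bool) :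
    ∑ s : Fin n → Bool, z ^ changes p s = (1 + z) ^ n := by
  induction n generalizing p with
  | zero => simp [changes]
  | succ n ih =>
    rw [← (Fin.consEquiv fun _ => Bool).sum_comp, Fintype.sum_prod_type]
    have : ∀ b, ∑ s : Fin n → Bool, z ^ changes p ((Fin.consEquiv fun _ => Bool) (b, s)) =
        z ^ (if p = b then 0 else 1) * (1 + z) ^ n := by
      intro b
      rw [← ih b, Finset.mul_sum]
      refine Finset.sum_congr rfl fun s _ => ?_
      simp [changes, pow_add, Fin.consEquiv]
    simp only [this, Fintype.sum_bool]
    cases p <;> simp <;> ring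

/-! ### Thresholding a vector, and sorting it -/

/-- The number of runs of 1's in the string that holds a 1 where `U` is at most `x`. -/
def levelRuns {α : Type*} [LinearOrder α] {n : ℕ} (U : Fin n → α) (x : α) : ℕ :=
  runCount fun k => decide (U k ≤ x)

/-- If m coordinates are at most `x`, they are the first m in sorted order, so the threshold string
is the string after m steps. Ties do no harm here. -/
lemma levelRuns_le_maxRuns {α : Type*} [LinearOrder α] {n : ℕ} (U : Fin n → α) (x : α) :
    levelRuns U x ≤ maxRuns (Tuple.sort U) := by
  classical
  set m := Fintype.card {i // (U ∘ Tuple.sort U) i ≤ x} with hm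
  have hmn : m ≤ n := (Fintype.card_subtype_le _).trans (by simp)
  have : (fun k => decide (U k ≤ x)) = stringAt (Tuple.sort U) m := by
    ext k
    have h := Tuple.lt_card_le_iff_apply_le_of_monotone (a := x)
      (j := (Tuple.sort U).symm k) (Tuple.monotone_sort U)
    simp only [Function.comp_apply, Equiv.apply_symm_apply] at h
    simp only [stringAt]
    congr 1
    rw [eq_iff_iff, ← h, hm]
    simp [Fintype.card_subtype]
  rw [levelRuns, this, maxRuns]
  exact Finset.le_sup (f := fun m => runCount (stringAt (Tuple.sort U) m))
    (Finset.mem_range.2 (by omega))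

lemma maxRuns_le {n : ℕ} (σ : Equiv.Perm (Fin n)) : maxRuns σ ≤ n :=
  Finset.sup_le fun _ _ => runCount_le _

/-- For an injective vector the maximum is attained at a threshold that is a value of it. -/
lemma maxRuns_sort_eq_zero_or {α : Type*} [LinearOrder α] {n : ℕ} {U : Fin n → α}
    (hU : Function.Injective U) :
    maxRuns (Tuple.sort U) = 0 ∨ ∃ j, maxRuns (Tuple.sort U) = levelRuns U (U j) := by
  obtain ⟨m, hm, h⟩ := Finset.exists_mem_eq_sup (Finset.range (n + 1)) ⟨0, by simp⟩
    fun m => runCount (stringAt (Tuple.sort U) m)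
  have hs : StrictMono (U ∘ Tuple.sort U) :=
    (Tuple.monotone_sort U).strictMono_of_injective (hU.comp (Equiv.injective _))
  rw [maxRuns, h]
  cases m with
  | zero => exact Or.inl (runCount_of_eq_false fun k => by simp [stringAt])
  | succ j =>
    have hj : j < n := by simpa using hm
    refine Or.inr ⟨Tuple.sort U ⟨j, hj⟩, ?_⟩
    rw [levelRuns]
    congr 1
    ext k
    simp only [stringAt]
    congr 1
    have := hs.le_iff_le (a := (Tuple.sort U).symm k) (b := ⟨j, hj⟩)
    simp only [Function.comp_apply, Equiv.apply_symm_apply] at this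
    rw [eq_iff_iff, this, Fin.le_def, Nat.lt_succ_iff]

lemma levelRuns_update_le {α : Type*} [LinearOrder α] {n : ℕ} (U : Fin n → α) (j : Fin n)
    (x y : α) : levelRuns (Function.update U j y) x ≤ levelRuns U x + 2 :=
  runCount_le_add_two j fun k hk => by simp [hk]

lemma levelRuns_le_update {α : Type*} [LinearOrder α] {n : ℕ} (U : Fin n → α) (j : Fin n)
    (x y : α) : levelRuns U x ≤ levelRuns (Function.update U j y) x + 2 :=
  runCount_le_add_two j fun k hk => by simp [hk]

/-! ### Exponential moments at a fixed level of independent uniforms -/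

section IndependentUniforms

open scoped unitInterval

/-- A product over pairs of coordinates, no two of which share a coordinate, has expectation at
most the product of the bounds. -/
lemma lintegral_prod_pairs_le {ι κ E : Type*} [Fintype ι] [DecidableEq ι] [MeasurableSpace E]
    (μ : Measure E) [IsProbabilityMeasure μ] (a b : κ → ι) {φ : E → E → ℝ≥0∞}
    (hφ : Measurable (Function.uncurry φ)) {c : ℝ≥0∞} (hc : ∫⁻ x, ∫⁻ y, φ x y ∂μ ∂μ ≤ c)
    (hab : ∀ k, a k ≠ b k) (T : Finset κ)
    (hT : ∀ k ∈ T, ∀ l ∈ T, k ≠ l → a k ≠ a l ∧ a k ≠ b l ∧ b k ≠ b l) :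
    ∫⁻ U : ι → E, ∏ k ∈ T, φ (U (a k)) (U (b k)) ∂(Measure.pi fun _ => μ) ≤ c ^ T.card := by
  classical
  have hm : ∀ (T : Finset κ), Measurable fun U : ι → E => ∏ k ∈ T, φ (U (a k)) (U (b k)) := by
    intro T
    refine Finset.measurable_fun_prod _ fun k _ => ?_
    exact hφ.comp (f := fun U : ι → E => (U (a k), U (b k))) (by fun_prop)
  induction T using Finset.induction_on with
  | empty => simp
  | insert k T hk ih =>
    have ih := ih fun k hk l hl => hT k (Finset.mem_insert_of_mem hk) l (Finset.mem_insert_of_mem hl)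
    rw [Finset.card_insert_of_notMem hk, pow_succ']
    refine le_trans ?_ (mul_le_mul_right ih c)
    rw [← lintegral_const_mul _ (hm T)]
    -- Only the two coordinates of the new pair are integrated out; the other factors do not depend
    -- on them.
    refine lintegral_le_of_lmarginal_le {a k, b k} (hm _) ((hm T).const_mul c) fun U => ?_
    have hl : ∀ F : (ι → E) → ℝ≥0∞, Measurable F → (∫⋯∫⁻_{a k, b k}, F ∂fun _ => μ) U =
        ∫⁻ x, ∫⁻ y, F (Function.update (Function.update U (a k) x) (b k) y) ∂μ ∂μ := by
      intro F hF
      rw [lmarginal_insert _ hF (by simpa using hab k)]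
      simp only [lmarginal_singleton]
    rw [hl _ (hm _), hl _ ((hm T).const_mul c)]
    have hg : ∀ x y, ∏ l ∈ T, φ (Function.update (Function.update U (a k) x) (b k) y (a l))
        (Function.update (Function.update U (a k) x) (b k) y (b l)) =
        ∏ l ∈ T, φ (U (a l)) (U (b l)) := by
      intro x y
      refine Finset.prod_congr rfl fun l hl => ?_
      have hkl : k ≠ l := by rintro rfl; exact hk hl
      have h1 := hT k (Finset.mem_insert_self k T) l (Finset.mem_insert_of_mem hl) hkl
      have h2 := hT l (Finset.mem_insert_of_mem hl) k (Finset.mem_insert_self k T) hkl.symm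
      rw [Function.update_of_ne h2.2.1, Function.update_of_ne h1.1.symm,
        Function.update_of_ne h1.2.2.symm, Function.update_of_ne h1.2.1.symm]
    simp only [Finset.prod_insert hk, hg, Function.update_self, Function.update_of_ne (hab k)]
    have hφ' : ∀ x, Measurable (φ x) := fun x => hφ.comp (measurable_prodMk_left (x := x))
    simp only [lintegral_const, measure_univ, mul_one]
    calc ∫⁻ x, ∫⁻ y, φ x y * ∏ l ∈ T, φ (U (a l)) (U (b l)) ∂μ ∂μ
        = ∫⁻ x, (∫⁻ y, φ x y ∂μ) * ∏ l ∈ T, φ (U (a l)) (U (b l)) ∂μ := by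
          refine lintegral_congr fun x => lintegral_mul_const _ (hφ' x)
      _ = (∫⁻ x, ∫⁻ y, φ x y ∂μ ∂μ) * ∏ l ∈ T, φ (U (a l)) (U (b l)) :=
          lintegral_mul_const _ hφ.lintegral_prod_right
      _ ≤ _ := mul_le_mul_left hc _

/-- Indicator (as a real number) of a run starting at a place with threshold `x`: the value `u`
on the left is above the threshold and the value `w` is not. -/
noncomputable def ascentInd (x : I) (u w : I) : ℝ := if x < u ∧ w ≤ x then 1 else 0

/-- The midpoint of the unit interval. -/
noncomputable def midI : I := ⟨1 / 2, by norm_num, by norm_num⟩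

lemma measurable_ascentInd (x : I) : Measurable (Function.uncurry (ascentInd x)) := by
  refine Measurable.ite ?_ measurable_const measurable_const
  exact (measurable_fst (measurableSet_Ioi (a := x))).inter
    (measurable_snd (measurableSet_Iic (a := x)))

lemma integral_ascentInd (x : I) :
    ∫ p : I × I, Function.uncurry (ascentInd x) p = x * (1 - x) := by
  have : Function.uncurry (ascentInd x) = (Set.Ioi x ×ˢ Set.Iic x).indicator 1 := by
    ext ⟨u, w⟩
    simp [ascentInd, Set.indicator_apply]
  rw [this, integral_indicator_one (measurableSet_Ioi.prod measurableSet_Iic), Measure.real,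
    Measure.volume_eq_prod, Measure.prod_prod, ENNReal.toReal_mul, unitInterval.volume_Ioi,
    unitInterval.volume_Iic, ENNReal.toReal_ofReal x.2.1,
    ENNReal.toReal_ofReal (sub_nonneg.2 x.2.2), mul_comm]

lemma integrable_ascentInd (x : I) : Integrable (Function.uncurry (ascentInd x)) := by
  refine Integrable.of_bound (measurable_ascentInd x).aestronglyMeasurable 1
    (Eventually.of_forall fun p => ?_)
  simp only [Function.uncurry, ascentInd]
  split_ifs <;> simp

/-- The two indicators can differ only if `u` or `w` lies between the two levels. -/
lemma sq_ascentInd_sub_le (x y u w : I) :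
    (ascentInd x u w - ascentInd y u w) ^ 2 ≤
      (Set.uIcc x y).indicator 1 u + (Set.uIcc x y).indicator 1 w := by
  have h0 : ∀ z : I, (0 : ℝ) ≤ (Set.uIcc x y).indicator 1 z := fun z =>
    Set.indicator_nonneg (fun _ _ => zero_le_one) z
  have hz : ∀ z, z ∉ Set.uIcc x y → ((x < z ↔ y < z) ∧ (z ≤ x ↔ z ≤ y)) := by
    intro z hz
    rw [Set.mem_uIcc] at hz
    push Not at hz
    grind
  by_cases hu : u ∈ Set.uIcc x y
  · have : (ascentInd x u w - ascentInd y u w) ^ 2 ≤ 1 := by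
      simp only [ascentInd]
      split_ifs <;> simp
    rw [Set.indicator_of_mem hu]
    have := h0 w
    simp only [Pi.one_apply]
    linarith
  by_cases hw : w ∈ Set.uIcc x y
  · have : (ascentInd x u w - ascentInd y u w) ^ 2 ≤ 1 := by
      simp only [ascentInd]
      split_ifs <;> simp
    rw [Set.indicator_of_mem hw]
    have := h0 u
    simp only [Pi.one_apply]
    linarith
  · have : ascentInd x u w = ascentInd y u w := by
      simp only [ascentInd, (hz u hu).1, (hz w hw).2]
    rw [this, sub_self]
    have := h0 u
    have := h0 w
    norm_num
    linarith

/-- The core estimate. With d = |x - 1/2|, the difference V of the indicators has mean -d² and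
second moment at most 2d. Since e^y ≤ 1 + y + y² for |y| ≤ 1, the integral is at most 1 - l d² + 2
l² d = 1 + l³ - l (d - l)². The negative drift thus absorbs the variance, uniformly in `x`. -/
lemma lintegral_exp_ascentInd_le (x : I) {l : ℝ} (h0 : 0 ≤ l) (h1 : l ≤ 1) :
    ∫⁻ u : I, ∫⁻ w : I, ENNReal.ofReal (Real.exp (l * (ascentInd x u w - ascentInd midI u w))) ≤
      ENNReal.ofReal (Real.exp (l ^ 3)) := by
  set V : I × I → ℝ := fun p => Function.uncurry (ascentInd x) p -
    Function.uncurry (ascentInd midI) p with hV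
  set Q : I × I → ℝ := fun p => (Set.uIcc x midI).indicator 1 p.1 +
    (Set.uIcc x midI).indicator 1 p.2 with hQ
  have hVm : Measurable V := (measurable_ascentInd x).sub (measurable_ascentInd midI)
  have hVi : Integrable V := (integrable_ascentInd x).sub (integrable_ascentInd midI)
  have hind : Integrable ((Set.uIcc x midI).indicator (1 : I → ℝ)) :=
    (integrable_indicator_iff measurableSet_uIcc).2 (integrableOn_const (by simp))
  have hQ1 : Integrable fun p : I × I => (Set.uIcc x midI).indicator (1 : I → ℝ) p.1 :=
    hind.comp_fst _
  have hQ2 : Integrable fun p : I × I => (Set.uIcc x midI).indicator (1 : I → ℝ) p.2 :=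
    hind.comp_snd _
  have hvol : (volume : Measure I).real (Set.uIcc x midI) = |(x : ℝ) - 1 / 2| := by
    rw [Measure.real, unitInterval.volume_uIcc, edist_dist, Subtype.dist_eq, Real.dist_eq,
      ENNReal.toReal_ofReal (abs_nonneg _), abs_sub_comm]
    rfl
  have hQint : ∫ p, Q p = 2 * |(x : ℝ) - 1 / 2| := by
    rw [hQ, integral_add hQ1 hQ2, Measure.volume_eq_prod, integral_fun_fst, integral_fun_snd,
      integral_indicator_one measurableSet_uIcc, hvol]
    simp
    ring
  have hVint : ∫ p, V p = -((x : ℝ) - 1 / 2) ^ 2 := by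
    rw [hV, integral_sub (integrable_ascentInd x) (integrable_ascentInd midI),
      integral_ascentInd, integral_ascentInd]
    simp only [midI]
    ring
  have hpt : ∀ p, Real.exp (l * V p) ≤ 1 + l * V p + l ^ 2 * Q p := by
    intro p
    have hV1 : |V p| ≤ 1 := by
      simp only [hV, Function.uncurry, ascentInd]
      split_ifs <;> simp
    have : |l * V p| ≤ 1 := by
      rw [abs_mul, abs_of_nonneg h0]
      exact mul_le_one₀ h1 (abs_nonneg _) hV1
    have h2 := (abs_le.1 (Real.abs_exp_sub_one_sub_id_le this)).2
    have h3 : V p ^ 2 ≤ Q p := sq_ascentInd_sub_le x midI p.1 p.2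
    have := mul_le_mul_of_nonneg_left h3 (sq_nonneg l)
    nlinarith
  have hmE : Measurable fun p => ENNReal.ofReal (Real.exp (l * V p)) := by fun_prop
  have hB : Integrable fun p => 1 + l * V p + l ^ 2 * Q p :=
    ((integrable_const _).add (hVi.const_mul l)).add ((hQ1.add hQ2).const_mul _)
  calc ∫⁻ u : I, ∫⁻ w : I, ENNReal.ofReal (Real.exp (l * (ascentInd x u w - ascentInd midI u w)))
      = ∫⁻ p : I × I, ENNReal.ofReal (Real.exp (l * V p)) := by
        rw [Measure.volume_eq_prod, lintegral_prod _ hmE.aemeasurable]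
        rfl
    _ ≤ ∫⁻ p : I × I, ENNReal.ofReal (1 + l * V p + l ^ 2 * Q p) :=
        lintegral_mono fun p => ENNReal.ofReal_le_ofReal (hpt p)
    _ = ENNReal.ofReal (∫ p : I × I, (1 + l * V p + l ^ 2 * Q p)) := by
        rw [ofReal_integral_eq_lintegral_ofReal hB]
        exact Eventually.of_forall fun p => (Real.exp_pos _).le.trans (hpt p)
    _ ≤ _ := by
        refine ENNReal.ofReal_le_ofReal ?_
        rw [integral_add (f := fun p => 1 + l * V p) (g := fun p => l ^ 2 * Q p)
            ((integrable_const _).add (hVi.const_mul l)) ((hQ1.add hQ2).const_mul _),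
          integral_add (f := fun _ => 1) (g := fun p => l * V p) (integrable_const _)
            (hVi.const_mul l), integral_const_mul, integral_const_mul, hQint, hVint]
        simp only [integral_const, probReal_univ, smul_eq_mul, mul_one]
        refine le_trans ?_ (Real.add_one_le_exp _)
        rw [← sq_abs ((x : ℝ) - 1 / 2)]
        nlinarith [mul_nonneg h0 (sq_nonneg (|(x : ℝ) - 1 / 2| - l))]

lemma levelRuns_eq_sum {m : ℕ} (U : Fin (m + 1) → I) (x : I) :
    (levelRuns U x : ℝ) = (if U 0 ≤ x then 1 else 0) +
      ∑ k : Fin m, ascentInd x (U k.castSucc) (U k.succ) := by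
  rw [levelRuns, runCount_succ]
  push_cast
  simp only [decide_eq_true_eq, decide_eq_false_iff_not, not_le, ascentInd]

/-- Exponential moments of the difference between the number of runs at level `x` and at the
middle level. -/
lemma lintegral_exp_levelRuns_sub_le (n : ℕ) (x : I) {l : ℝ} (h0 : 0 ≤ l) (h1 : l ≤ 1 / 2) :
    ∫⁻ U : Fin n → I, ENNReal.ofReal
        (Real.exp (l * ((levelRuns U x : ℝ) - levelRuns U midI))) ≤
      ENNReal.ofReal (Real.exp (l + 8 * n * l ^ 3)) := by
  classical
  cases n with
  | zero =>
    simp only [levelRuns, runCount_zero, sub_self, mul_zero, Real.exp_zero, ENNReal.ofReal_one,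
      lintegral_const, measure_univ, mul_one]
    rw [← ENNReal.ofReal_one]
    exact ENNReal.ofReal_le_ofReal (Real.one_le_exp (by positivity))
  | succ m =>
    let V : I → I → ℝ := fun u w => ascentInd x u w - ascentInd midI u w
    -- Consecutive pairs share a coordinate, so the ascents are split by the parity of their place.
    -- Separating the two classes by e^(a+b) ≤ (e^(2a) + e^(2b))/2 doubles the exponent, whence `l ≤
    -- 1 / 2` and the constant 8 = 2³.
    let φ : I → I → ℝ≥0∞ := fun u w => ENNReal.ofReal (Real.exp (2 * l * V u w))
    have hV : Measurable (Function.uncurry V) :=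
      (measurable_ascentInd x).sub (measurable_ascentInd midI)
    have hφ : Measurable (Function.uncurry φ) := by
      change Measurable fun p => ENNReal.ofReal (Real.exp (2 * l * Function.uncurry V p))
      fun_prop
    have hc : ∫⁻ u, ∫⁻ w, φ u w ≤ ENNReal.ofReal (Real.exp ((2 * l) ^ 3)) :=
      lintegral_exp_ascentInd_le x (by linarith) (by linarith)
    have hbound : ∀ c : Bool, ∫⁻ U : Fin (m + 1) → I,
        ∏ k ∈ Finset.univ.filter (fun k : Fin m => decide (Even (k : ℕ)) = c),
          φ (U k.castSucc) (U k.succ) ≤ ENNReal.ofReal (Real.exp (8 * (m + 1 : ℕ) * l ^ 3)) := by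
      intro c
      set T := Finset.univ.filter (fun k : Fin m => decide (Even (k : ℕ)) = c) with hT
      refine (lintegral_prod_pairs_le (volume : Measure I) (fun k : Fin m => k.castSucc)
        (fun k : Fin m => k.succ) hφ hc (fun k => (Fin.castSucc_lt_succ).ne) T ?_).trans ?_
      · intro k hk j hj hkj
        simp only [T, Finset.mem_filter, Finset.mem_univ, true_and] at hk hj
        have hkj' : (k : ℕ) ≠ j := fun h => hkj (Fin.ext h)
        refine ⟨by simpa using hkj, fun h => ?_, by simpa using hkj⟩
        have h' : (k : ℕ) = j + 1 := by simpa using congrArg Fin.val h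
        rw [← hj, h', decide_eq_decide, Nat.even_add_one] at hk
        tauto
      · rw [← ENNReal.ofReal_pow (Real.exp_pos _).le, ← Real.exp_nat_mul]
        refine ENNReal.ofReal_le_ofReal (Real.exp_le_exp.2 ?_)
        have hTm : (T.card : ℝ) ≤ (m + 1 : ℕ) := by
          have : T.card ≤ m := (Finset.card_le_univ _).trans (by simp)
          exact_mod_cast this.trans (Nat.le_succ m)
        have : (0 : ℝ) ≤ 8 * l ^ 3 := by positivity
        nlinarith [mul_le_mul_of_nonneg_right hTm this]
    have hprod : ∀ (c : Bool) (U : Fin (m + 1) → I),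
        ∏ k ∈ Finset.univ.filter (fun k : Fin m => decide (Even (k : ℕ)) = c),
          φ (U k.castSucc) (U k.succ) = ENNReal.ofReal (Real.exp (2 * l *
            ∑ k ∈ Finset.univ.filter (fun k : Fin m => decide (Even (k : ℕ)) = c),
              V (U k.castSucc) (U k.succ))) := by
      intro c U
      rw [Finset.mul_sum, Real.exp_sum, ENNReal.ofReal_prod_of_nonneg fun _ _ => (Real.exp_pos _).le]
    have hpt : ∀ U : Fin (m + 1) → I, ENNReal.ofReal
        (Real.exp (l * ((levelRuns U x : ℝ) - levelRuns U midI))) ≤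
        ENNReal.ofReal (Real.exp l / 2) *
        (∏ k ∈ Finset.univ.filter (fun k : Fin m => decide (Even (k : ℕ)) = true),
          φ (U k.castSucc) (U k.succ) +
        ∏ k ∈ Finset.univ.filter (fun k : Fin m => decide (Even (k : ℕ)) = false),
          φ (U k.castSucc) (U k.succ)) := by
      intro U
      rw [hprod, hprod, ← ENNReal.ofReal_add (Real.exp_pos _).le (Real.exp_pos _).le,
        ← ENNReal.ofReal_mul (by positivity)]
      refine ENNReal.ofReal_le_ofReal ?_
      set a := ∑ k ∈ Finset.univ.filter (fun k : Fin m => decide (Even (k : ℕ)) = true),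
              V (U k.castSucc) (U k.succ)
      set b := ∑ k ∈ Finset.univ.filter (fun k : Fin m => decide (Even (k : ℕ)) = false),
              V (U k.castSucc) (U k.succ)
      -- The 1 accounts for a run starting at the first place, which has no left neighbour.
      have hab : (levelRuns U x : ℝ) - levelRuns U midI ≤ 1 + (a + b) := by
        have : a + b = ∑ k : Fin m, V (U k.castSucc) (U k.succ) := by
          rw [← Finset.sum_filter_add_sum_filter_not Finset.univ
            (fun k : Fin m => decide (Even (k : ℕ)) = true)]
          simp [a, b]
        rw [this, levelRuns_eq_sum, levelRuns_eq_sum, Finset.sum_sub_distrib]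
        have : (if U 0 ≤ x then (1 : ℝ) else 0) ≤ 1 := by split_ifs <;> norm_num
        have : (0 : ℝ) ≤ (if U 0 ≤ midI then (1 : ℝ) else 0) := by split_ifs <;> norm_num
        linarith
      calc Real.exp (l * ((levelRuns U x : ℝ) - levelRuns U midI))
          ≤ Real.exp (l + (l * a + l * b)) := by
            refine Real.exp_le_exp.2 ?_
            nlinarith [mul_le_mul_of_nonneg_left hab h0]
        _ = Real.exp l * (Real.exp (l * a) * Real.exp (l * b)) := by rw [Real.exp_add, Real.exp_add]
        _ ≤ Real.exp l * ((Real.exp (l * a) ^ 2 + Real.exp (l * b) ^ 2) / 2) := by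
            gcongr
            nlinarith [sq_nonneg (Real.exp (l * a) - Real.exp (l * b))]
        _ = _ := by
            rw [← Real.exp_nat_mul, ← Real.exp_nat_mul]
            push_cast
            ring_nf
    refine (lintegral_mono hpt).trans ?_
    have hm : ∀ c : Bool, Measurable fun U : Fin (m + 1) → I =>
        ∏ k ∈ Finset.univ.filter (fun k : Fin m => decide (Even (k : ℕ)) = c),
          φ (U k.castSucc) (U k.succ) := fun c => Finset.measurable_fun_prod _ fun k _ =>
      hφ.comp (f := fun U : Fin (m + 1) → I => (U k.castSucc, U k.succ)) (by fun_prop)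
    rw [lintegral_const_mul _ (by exact (hm true).add (hm false)), lintegral_add_left (hm true)]
    refine (mul_le_mul_right (add_le_add (hbound true) (hbound false)) _).trans ?_
    rw [← ENNReal.ofReal_add (Real.exp_pos _).le (Real.exp_pos _).le,
      ← ENNReal.ofReal_mul (by positivity), Real.exp_add]
    exact ENNReal.ofReal_le_ofReal (by linarith)

/-! ### Sorting independent uniforms gives a uniform permutation -/

lemma measurable_levelRuns (n : ℕ) :
    Measurable fun p : (Fin n → I) × I => levelRuns p.1 p.2 := by
  refine (measurable_of_finite (runCount (n := n))).comp
    (measurable_pi_iff.2 fun k => measurable_to_bool ?_)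
  have : ((fun p : (Fin n → I) × I => decide (p.1 k ≤ p.2)) ⁻¹' {true}) = {p | p.1 k ≤ p.2} := by
    ext p
    simp
  rw [this]
  exact measurableSet_le (by fun_prop) (by fun_prop)

lemma ae_injective (n : ℕ) : ∀ᵐ U : Fin n → I, Function.Injective U := by
  have h : ∀ i j : Fin n, i ≠ j → ∀ᵐ U : Fin n → I, U i ≠ U j := by
    intro i j hij
    have hm : MeasurableSet {U : Fin n → I | U i = U j} :=
      measurableSet_eq_fun (by fun_prop) (by fun_prop)
    have : volume {U : Fin n → I | U i = U j} = 0 := by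
      rw [← lintegral_indicator_one hm, ← nonpos_iff_eq_zero]
      refine (lintegral_le_of_lmarginal_le (g := 0) {i} (measurable_one.indicator hm)
        measurable_zero fun U => ?_).trans (by simp)
      rw [lmarginal_singleton, lmarginal_singleton]
      have : ∀ y : I, ({U : Fin n → I | U i = U j}.indicator 1 (Function.update U i y) : ℝ≥0∞) =
          ({U j} : Set I).indicator 1 y := by
        intro y
        simp [Set.indicator_apply, Function.update_of_ne hij.symm]
      simp only [this]
      rw [lintegral_indicator_one (measurableSet_singleton _)]
      simp
    exact measure_eq_zero_iff_ae_notMem.1 this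
  have h' : ∀ᵐ U : Fin n → I, ∀ i j, i ≠ j → U i ≠ U j := by
    rw [ae_all_iff]
    intro i
    rw [ae_all_iff]
    intro j
    by_cases hij : i = j
    · simp [hij]
    · filter_upwards [h i j hij] with U hU _ using hU
  filter_upwards [h'] with U hU i j hij
  by_contra hne
  exact hU i j hne hij

lemma measurableSet_sort_eq {n : ℕ} (π : Equiv.Perm (Fin n)) :
    MeasurableSet {U : Fin n → I | Tuple.sort U = π} := by
  have : {U : Fin n → I | Tuple.sort U = π} = {U | (∀ i j, i ≤ j → U (π i) ≤ U (π j)) ∧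
      ∀ i j, i < j → U (π i) = U (π j) → π i < π j} := by
    ext U
    rw [Set.mem_ofPred_eq, eq_comm, Tuple.eq_sort_iff]
    rfl
  rw [this]
  measurability

/-- Without ties, `Tuple.sort U = π` means that `U ∘ π` is monotone. By exchangeability this has the
same probability for every `π`, and the n! probabilities add up to 1. -/
lemma isUniformPerm_sort (n : ℕ) :
    IsUniformPerm (fun U : Fin n → I => Tuple.sort U) volume := by
  have hset : ∀ π : Equiv.Perm (Fin n), volume {U : Fin n → I | Tuple.sort U = π} =
      volume {U : Fin n → I | Monotone (U ∘ π)} := by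
    intro π
    refine measure_congr ?_
    filter_upwards [ae_injective n] with U hU
    refine propext ⟨?_, fun h => ?_⟩
    · rintro rfl
      exact Tuple.monotone_sort U
    · have := Tuple.unique_monotone h (Tuple.monotone_sort U)
      exact Equiv.ext fun i => (hU (congrFun this i)).symm
  have hinv : ∀ π : Equiv.Perm (Fin n), volume {U : Fin n → I | Monotone (U ∘ π)} =
      volume {U : Fin n → I | Monotone U} := by
    intro π
    have hmp := volume_measurePreserving_piCongrLeft (fun _ : Fin n => I) π.symm
    have he : ∀ U, MeasurableEquiv.piCongrLeft (fun _ : Fin n => I) π.symm U = U ∘ π := by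
      intro U
      ext1 i
      have := MeasurableEquiv.piCongrLeft_apply_apply (β := fun _ : Fin n => I) π.symm U (π i)
      simpa using this
    have hm : MeasurableSet {U : Fin n → I | Monotone U} := by
      simp only [Monotone]
      measurability
    rw [← hmp.measure_preimage hm.nullMeasurableSet]
    simp only [Set.preimage_ofPred_eq, he]
  have hsum : ∑ π : Equiv.Perm (Fin n), volume {U : Fin n → I | Tuple.sort U = π} = 1 := by
    have := sum_measure_preimage_singleton (μ := (volume : Measure (Fin n → I))) Finset.univ
      (f := fun U : Fin n → I => Tuple.sort U) fun π _ => measurableSet_sort_eq π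
    rw [Finset.coe_univ, Set.preimage_univ, measure_univ] at this
    exact this
  intro π
  refine ⟨measurableSet_sort_eq π, ?_⟩
  simp only [hset, hinv, Finset.sum_const, Finset.card_univ, Fintype.card_perm, Fintype.card_fin,
    nsmul_eq_mul] at hsum ⊢
  exact ENNReal.eq_inv_of_mul_eq_one_left (by rw [mul_comm]; exact hsum)

section Law

variable {Ω β : Type*} [MeasurableSpace Ω] [MeasurableSpace β] {n : ℕ}
  {τ : Ω → Equiv.Perm (Fin n)} {P : Measure Ω}

lemma IsUniformPerm.measurable_comp (h : IsUniformPerm τ P) (g : Equiv.Perm (Fin n) → β) :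
    Measurable fun ω => g (τ ω) := by
  intro s _
  have : (fun ω => g (τ ω)) ⁻¹' s = ⋃ π ∈ {π | g π ∈ s}, {ω | τ ω = π} := by
    ext ω
    simp
  rw [this]
  exact MeasurableSet.biUnion (Set.toFinite _).countable fun π _ => (h π).1

/-- The right side involves neither `Ω` nor `τ`, so every uniform permutation may be replaced by the
sorted uniform vector. -/
lemma IsUniformPerm.map_comp (h : IsUniformPerm τ P) (g : Equiv.Perm (Fin n) → β) :
    P.map (fun ω => g (τ ω)) =
      ∑ π : Equiv.Perm (Fin n), ((n.factorial : ℝ≥0∞))⁻¹ • Measure.dirac (g π) := by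
  classical
  ext s hs
  rw [Measure.map_apply (h.measurable_comp g) hs]
  have : (fun ω => g (τ ω)) ⁻¹' s = ⋃ π ∈ Finset.univ.filter (fun π => g π ∈ s),
      {ω | τ ω = π} := by
    ext ω
    simp
  rw [this, measure_biUnion_finset (fun π _ π' _ hne => Set.disjoint_left.2 fun ω h1 h2 =>
    hne (h1.symm.trans h2)) (fun π _ => (h π).1)]
  simp [(h _).2, Measure.dirac_apply' _ hs, Set.indicator_apply, Finset.sum_ite, mul_comm]

end Law

/-! ### The excess of the maximum over the middle level -/

/-- Resampling the coordinate `j`: a run count at the random level `U j` behaves like one at an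
independent level. -/
lemma lintegral_exp_levelRuns_self_le (n : ℕ) (j : Fin n) {l : ℝ} (h0 : 0 ≤ l) (h1 : l ≤ 1 / 2) :
    ∫⁻ U : Fin n → I, ENNReal.ofReal
        (Real.exp (l * ((levelRuns U (U j) : ℝ) - levelRuns U midI))) ≤
      ENNReal.ofReal (Real.exp (5 * l + 8 * n * l ^ 3)) := by
  let H : (Fin n → I) × I → ℝ≥0∞ := fun p =>
    ENNReal.ofReal (Real.exp (l * ((levelRuns p.1 p.2 : ℝ) - levelRuns p.1 midI)))
  have hH : Measurable H := by
    have h1 : Measurable fun p : (Fin n → I) × I => (levelRuns p.1 p.2 : ℝ) :=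
      (measurable_of_countable (Nat.cast : ℕ → ℝ)).comp (measurable_levelRuns n)
    have h2 : Measurable fun p : (Fin n → I) × I => (levelRuns p.1 midI : ℝ) :=
      h1.comp (f := fun p : (Fin n → I) × I => (p.1, midI)) (by fun_prop)
    fun_prop
  have hF : Measurable fun U : Fin n → I => H (U, U j) := hH.comp (by fun_prop)
  have hG : Measurable fun U : Fin n → I => ∫⁻ y, H (Function.update U j y, y) := by
    refine Measurable.lintegral_prod_right' (f := fun p : (Fin n → I) × I =>
      H (Function.update p.1 j p.2, p.2)) (hH.comp ?_)
    exact Measurable.prodMk (measurable_update' (a := j)) measurable_snd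
  calc ∫⁻ U : Fin n → I, H (U, U j) = ∫⁻ U : Fin n → I, ∫⁻ y, H (Function.update U j y, y) := by
        refine lintegral_eq_of_lmarginal_eq {j} hF hG ?_
        ext U
        simp [lmarginal_singleton]
    _ ≤ ∫⁻ U : Fin n → I, ∫⁻ y, ENNReal.ofReal (Real.exp (4 * l)) * H (U, y) := by
        refine lintegral_mono fun U => lintegral_mono fun y => ?_
        rw [← ENNReal.ofReal_mul (Real.exp_pos _).le, ← Real.exp_add]
        refine ENNReal.ofReal_le_ofReal (Real.exp_le_exp.2 ?_)
        -- Changing coordinate `j` costs at most 2 runs at level `y` and 2 at the middle level: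
        -- together the factor exp (4 l).
        have h2 : (levelRuns (Function.update U j y) y : ℝ) ≤ levelRuns U y + 2 := by
          exact_mod_cast levelRuns_update_le U j y y
        have h3 : (levelRuns U midI : ℝ) ≤ levelRuns (Function.update U j y) midI + 2 := by
          exact_mod_cast levelRuns_le_update U j midI y
        nlinarith
    _ = ENNReal.ofReal (Real.exp (4 * l)) * ∫⁻ y, ∫⁻ U : Fin n → I, H (U, y) := by
        rw [lintegral_lintegral_swap (hH.const_mul _).aemeasurable]
        have hy : ∀ y, ∫⁻ U : Fin n → I, ENNReal.ofReal (Real.exp (4 * l)) * H (U, y) =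
            ENNReal.ofReal (Real.exp (4 * l)) * ∫⁻ U : Fin n → I, H (U, y) := fun y =>
          lintegral_const_mul _ (hH.comp (f := fun U : Fin n → I => (U, y)) (by fun_prop))
        simp_rw [hy]
        exact lintegral_const_mul _ hH.lintegral_prod_left
    _ ≤ ENNReal.ofReal (Real.exp (4 * l)) *
          ∫⁻ _ : I, ENNReal.ofReal (Real.exp (l + 8 * n * l ^ 3)) := by
        gcongr with y
        exact lintegral_exp_levelRuns_sub_le n y h0 h1
    _ = _ := by
        rw [lintegral_const, measure_univ, mul_one, ← ENNReal.ofReal_mul (Real.exp_pos _).le,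
          ← Real.exp_add]
        ring_nf

/-- The excess of the maximal number of runs over the number of runs at the middle level. -/
noncomputable def excess {n : ℕ} (U : Fin n → I) : ℝ :=
  (maxRuns (Tuple.sort U) : ℝ) - levelRuns U midI

lemma excess_nonneg {n : ℕ} (U : Fin n → I) : 0 ≤ excess U :=
  sub_nonneg.2 (by exact_mod_cast levelRuns_le_maxRuns U midI)

lemma excess_le {n : ℕ} (U : Fin n → I) : excess U ≤ n := by
  have h1 : (maxRuns (Tuple.sort U) : ℝ) ≤ n := by exact_mod_cast maxRuns_le _
  have h2 : (0 : ℝ) ≤ levelRuns U midI := Nat.cast_nonneg _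
  rw [excess]
  linarith

lemma measurable_levelRuns_midI (n : ℕ) :
    Measurable fun U : Fin n → I => (levelRuns U midI : ℝ) :=
  (measurable_of_countable (Nat.cast : ℕ → ℝ)).comp ((measurable_levelRuns n).comp
    (f := fun U : Fin n → I => (U, midI)) (by fun_prop))

lemma measurable_excess (n : ℕ) : Measurable fun U : Fin n → I => excess U :=
  ((isUniformPerm_sort n).measurable_comp fun π => (maxRuns π : ℝ)).sub
    (measurable_levelRuns_midI n)

/-- A union bound in exponential form: almost surely the maximum is attained at one of the n levels
`U j`, and the extra 1 covers the case that it is 0. -/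
lemma lintegral_exp_excess_le (n : ℕ) {l : ℝ} (h0 : 0 ≤ l) (h1 : l ≤ 1 / 2) :
    ∫⁻ U : Fin n → I, ENNReal.ofReal (Real.exp (l * excess U)) ≤
      ENNReal.ofReal (1 + n * Real.exp (5 * l + 8 * n * l ^ 3)) := by
  let F : Fin n → (Fin n → I) → ℝ≥0∞ := fun j U => ENNReal.ofReal
    (Real.exp (l * ((levelRuns U (U j) : ℝ) - levelRuns U midI)))
  have hF : ∀ j, Measurable (F j) := by
    intro j
    have h1 : Measurable fun U : Fin n → I => (levelRuns U (U j) : ℝ) :=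
      (measurable_of_countable (Nat.cast : ℕ → ℝ)).comp ((measurable_levelRuns n).comp
        (f := fun U : Fin n → I => (U, U j)) (by fun_prop))
    have h2 := measurable_levelRuns_midI n
    fun_prop
  calc ∫⁻ U : Fin n → I, ENNReal.ofReal (Real.exp (l * excess U))
      ≤ ∫⁻ U : Fin n → I, (1 + ∑ j, F j U) := by
        refine lintegral_mono_ae ?_
        filter_upwards [ae_injective n] with U hU
        rcases maxRuns_sort_eq_zero_or hU with h | ⟨j, h⟩
        · refine le_trans ?_ le_self_add
          rw [← ENNReal.ofReal_one]
          refine ENNReal.ofReal_le_ofReal (Real.exp_le_one_iff.2 ?_)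
          have h2 : (0 : ℝ) ≤ levelRuns U midI := Nat.cast_nonneg _
          rw [excess, h]
          push_cast
          nlinarith
        · refine le_trans ?_ le_add_self
          refine le_trans (le_of_eq ?_)
            (Finset.single_le_sum (f := fun j => F j U) (fun _ _ => zero_le) (Finset.mem_univ j))
          simp only [F, excess, h]
    _ = 1 + ∑ j, ∫⁻ U, F j U := by
        rw [lintegral_add_left measurable_const, lintegral_finsetSum _ fun j _ => hF j]
        simp
    _ ≤ 1 + ∑ _j : Fin n, ENNReal.ofReal (Real.exp (5 * l + 8 * n * l ^ 3)) := by
        gcongr with j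
        exact lintegral_exp_levelRuns_self_le n j h0 h1
    _ = _ := by
        rw [Finset.sum_const, Finset.card_univ, Fintype.card_fin, nsmul_eq_mul,
          ENNReal.ofReal_add zero_le_one (by positivity), ENNReal.ofReal_one,
          ENNReal.ofReal_mul (Nat.cast_nonneg _), ENNReal.ofReal_natCast]

lemma integrable_comp_excess {n : ℕ} {f : ℝ → ℝ} (hf : Continuous f) :
    Integrable fun U : Fin n → I => f (excess U) := by
  obtain ⟨C, hC⟩ := (isCompact_Icc (a := (0 : ℝ)) (b := n)).exists_bound_of_continuousOn
    hf.continuousOn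
  exact Integrable.of_bound (hf.measurable.comp (measurable_excess n)).aestronglyMeasurable C
    (Eventually.of_forall fun U => hC _ ⟨excess_nonneg U, excess_le U⟩)

/-- The choice l = n^(-1/3) makes n l³ = 1, and n ≥ 8 ensures l ≤ 1/2. The constant 12 comes from 5
l + 8 ≤ 11, one more unit absorbing the summand 1. -/
lemma integral_exp_excess_le {n : ℕ} (hn : 8 ≤ n) :
    ∫ U : Fin n → I, Real.exp ((n : ℝ) ^ (-(1 / 3) : ℝ) * excess U) ≤ Real.exp (12 + Real.log n) := by
  have hn' : (8 : ℝ) ≤ n := by exact_mod_cast hn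
  have hpos : (0 : ℝ) < n := by linarith
  set l := (n : ℝ) ^ (-(1 / 3) : ℝ) with hl
  have h0 : 0 ≤ l := by positivity
  have hl3 : n * l ^ 3 = 1 := by
    rw [hl, ← Real.rpow_natCast, ← Real.rpow_mul hpos.le]
    norm_num [Real.rpow_neg_one]
    exact mul_inv_cancel₀ hpos.ne'
  have h1 : l ≤ 1 / 2 := by
    by_contra hcon
    push Not at hcon
    have : (1 / 2 : ℝ) ^ 3 < l ^ 3 := pow_lt_pow_left₀ hcon (by norm_num) (by norm_num)
    nlinarith
  have h := lintegral_exp_excess_le n h0 h1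
  rw [← ofReal_integral_eq_lintegral_ofReal
    (integrable_comp_excess (f := fun x => Real.exp (l * x)) (by fun_prop))
    (Eventually.of_forall fun U => (Real.exp_pos _).le),
    ENNReal.ofReal_le_ofReal_iff (by positivity)] at h
  refine h.trans ?_
  rw [mul_assoc 8 (n : ℝ), hl3, add_comm 12 (Real.log n), Real.exp_add (Real.log n), Real.exp_log hpos]
  have h2 : Real.exp (5 * l + 8 * 1) ≤ Real.exp 11 := Real.exp_le_exp.2 (by linarith)
  have h3 : Real.exp 12 = Real.exp 11 * Real.exp 1 := by rw [← Real.exp_add]; norm_num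
  have h4 : (2 : ℝ) ≤ Real.exp 1 := by linarith [Real.add_one_le_exp (1 : ℝ)]
  have h5 : (1 : ℝ) ≤ Real.exp 11 := Real.one_le_exp (by norm_num)
  have h6 : (n : ℝ) * Real.exp (5 * l + 8 * 1) ≤ n * Real.exp 11 :=
    mul_le_mul_of_nonneg_left h2 hpos.le
  have h7 : (n : ℝ) * Real.exp 11 * 2 ≤ n * Real.exp 11 * Real.exp 1 :=
    mul_le_mul_of_nonneg_left h4 (by positivity)
  rw [h3]
  nlinarith

/-- A bound, tending to 0, for the size of `n^{-1/2}` times the excess. -/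
noncomputable def excessRate (n : ℕ) : ℝ := (n : ℝ) ^ (-(1 / 6) : ℝ) * (12 + Real.log n)

lemma tendsto_excessRate : Tendsto excessRate atTop (𝓝 0) := by
  have h1 : Tendsto (fun n : ℕ => (n : ℝ) ^ (-(1 / 6) : ℝ)) atTop (𝓝 0) :=
    (tendsto_rpow_neg_atTop (by norm_num)).comp tendsto_natCast_atTop_atTop
  have h2 : Tendsto (fun n : ℕ => Real.log n / (n : ℝ) ^ (1 / 6 : ℝ)) atTop (𝓝 0) :=
    (isLittleO_log_rpow_atTop (by norm_num : (0 : ℝ) < 1 / 6)).tendsto_div_nhds_zero.comp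
      tendsto_natCast_atTop_atTop
  have := (h1.mul_const 12).add h2
  simp only [zero_mul, add_zero] at this
  refine this.congr fun n => ?_
  rw [excessRate, Real.rpow_neg (Nat.cast_nonneg n)]
  ring

lemma inv_sqrt_mul_eq {n : ℕ} (hn : 0 < n) (x : ℝ) :
    (√(n : ℝ))⁻¹ * x = (n : ℝ) ^ (-(1 / 6) : ℝ) * ((n : ℝ) ^ (-(1 / 3) : ℝ) * x) := by
  have hpos : (0 : ℝ) < n := by exact_mod_cast hn
  rw [← mul_assoc, ← Real.rpow_add hpos, Real.sqrt_eq_rpow, ← Real.rpow_neg hpos.le]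
  norm_num

lemma integral_excess_le {n : ℕ} (hn : 8 ≤ n) :
    ∫ U : Fin n → I, (√(n : ℝ))⁻¹ * excess U ≤ excessRate n := by
  set A := 12 + Real.log n with hA
  set l := (n : ℝ) ^ (-(1 / 3) : ℝ) with hl
  -- This is y + 1 ≤ e^y at y = l * excess U - A; the shift by `A` makes the expectation of e^y at
  -- most 1.
  have hpt : ∀ U : Fin n → I, l * excess U ≤ A - 1 + Real.exp (-A) * Real.exp (l * excess U) := by
    intro U
    rw [← Real.exp_add]
    have := Real.add_one_le_exp (-A + l * excess U)
    linarith
  have hi := integrable_comp_excess (n := n) (f := fun x => Real.exp (l * x)) (by fun_prop)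
  have h1 : ∫ U : Fin n → I, l * excess U ≤ A := by
    refine (integral_mono (integrable_comp_excess (f := fun x => l * x) (by fun_prop))
      ((integrable_const (A - 1)).add (hi.const_mul (Real.exp (-A)))) hpt).trans ?_
    simp only [Pi.add_apply]
    rw [integral_add (integrable_const (A - 1)) (hi.const_mul (Real.exp (-A))), integral_const_mul]
    simp only [integral_const, probReal_univ, smul_eq_mul, one_mul]
    have := mul_le_mul_of_nonneg_left (integral_exp_excess_le hn) (Real.exp_pos (-A)).le
    rw [← Real.exp_add, hA, neg_add_cancel, Real.exp_zero] at this
    rw [hA, hl]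
    linarith
  simp only [inv_sqrt_mul_eq (by omega : 0 < n)]
  rw [integral_const_mul, excessRate]
  exact mul_le_mul_of_nonneg_left h1 (by positivity)

lemma integral_exp_excess_le_two_mul {n : ℕ} (hn : 8 ≤ n) :
    ∫ U : Fin n → I, Real.exp ((√(n : ℝ))⁻¹ * excess U) ≤ 2 * Real.exp (excessRate n) := by
  set A := 12 + Real.log n with hA
  set l := (n : ℝ) ^ (-(1 / 3) : ℝ) with hl
  set p := (n : ℝ) ^ (-(1 / 6) : ℝ) with hp
  have hn1 : (1 : ℝ) ≤ n := by exact_mod_cast (by omega : 1 ≤ n)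
  have hp0 : 0 ≤ p := by positivity
  have hp1 : p ≤ 1 := Real.rpow_le_one_of_one_le_of_nonpos hn1 (by norm_num)
  -- With y = l * excess U - A and 0 ≤ p ≤ 1, this is e^(p y) ≤ 1 + e^y.
  have hpt : ∀ U : Fin n → I, Real.exp ((√(n : ℝ))⁻¹ * excess U) ≤
      Real.exp (p * A) * (1 + Real.exp (-A) * Real.exp (l * excess U)) := by
    intro U
    rw [inv_sqrt_mul_eq (by omega : 0 < n), ← Real.exp_add]
    have h1 : p * (l * excess U) = p * A + p * (-A + l * excess U) := by ring
    rw [← hl, ← hp, h1, Real.exp_add]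
    gcongr
    rcases le_total 0 (-A + l * excess U) with h | h
    · have : Real.exp (p * (-A + l * excess U)) ≤ Real.exp (-A + l * excess U) :=
        Real.exp_le_exp.2 (mul_le_of_le_one_left h hp1)
      linarith
    · have : Real.exp (p * (-A + l * excess U)) ≤ 1 :=
        Real.exp_le_one_iff.2 (mul_nonpos_of_nonneg_of_nonpos hp0 h)
      linarith [Real.exp_pos (-A + l * excess U)]
  have hi := integrable_comp_excess (n := n) (f := fun x => Real.exp (l * x)) (by fun_prop)
  refine (integral_mono
    (integrable_comp_excess (f := fun x => Real.exp ((√(n : ℝ))⁻¹ * x)) (by fun_prop))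
    (((integrable_const 1).add (hi.const_mul (Real.exp (-A)))).const_mul (Real.exp (p * A)))
    hpt).trans ?_
  rw [integral_const_mul]
  simp only [Pi.add_apply]
  rw [integral_add (integrable_const 1) (hi.const_mul (Real.exp (-A))), integral_const_mul]
  simp only [integral_const, probReal_univ, smul_eq_mul, one_mul]
  have := mul_le_mul_of_nonneg_left (integral_exp_excess_le hn) (Real.exp_pos (-A)).le
  rw [← Real.exp_add, hA, neg_add_cancel, Real.exp_zero] at this
  rw [excessRate, mul_comm 2]
  gcongr
  rw [hA, hl]
  linarith

/-! ### Fair bits at the middle level -/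

/-- The string of fair bits that holds a 1 where `U` is at most one half. -/
noncomputable def fairBits {n : ℕ} (U : Fin n → I) : Fin n → Bool := fun k => decide (U k ≤ midI)

lemma measurable_fairBits (n : ℕ) : Measurable (fairBits (n := n)) := by
  refine measurable_pi_iff.2 fun k => measurable_to_bool ?_
  have : (fun U : Fin n → I => fairBits U k) ⁻¹' {true} = {U | U k ≤ midI} := by
    ext U
    simp [fairBits]
  rw [this]
  exact measurableSet_le (by fun_prop) measurable_const

lemma volume_fairBits_eq {n : ℕ} (s : Fin n → Bool) :
    volume {U : Fin n → I | fairBits U = s} = ENNReal.ofReal ((1 / 2) ^ n) := by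
  have h : {U : Fin n → I | fairBits U = s} =
      Set.univ.pi fun k => if s k = true then Set.Iic midI else Set.Ioi midI := by
    ext U
    simp only [Set.mem_ofPred_eq, funext_iff, Set.mem_univ_pi, fairBits]
    refine forall_congr' fun k => ?_
    cases s k <;> simp
  rw [h, volume_pi_pi]
  have : ∀ k, volume (if s k = true then Set.Iic midI else Set.Ioi midI) =
      ENNReal.ofReal (1 / 2) := by
    intro k
    split_ifs
    · rw [unitInterval.volume_Iic]
      rfl
    · rw [unitInterval.volume_Ioi]
      congr 1
      simp only [midI]
      norm_num
  simp only [this, Finset.prod_const, Finset.card_univ, Fintype.card_fin]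
  rw [← ENNReal.ofReal_pow (by norm_num)]

lemma integral_comp_fairBits {E : Type*} [NormedAddCommGroup E] [NormedSpace ℝ E] [CompleteSpace E]
    {n : ℕ} (F : (Fin n → Bool) → E) :
    ∫ U : Fin n → I, F (fairBits U) = ∑ s, ((1 / 2 : ℝ) ^ n) • F s := by
  have hF : StronglyMeasurable F := StronglyMeasurable.of_discrete
  rw [← integral_map (measurable_fairBits n).aemeasurable hF.aestronglyMeasurable,
    integral_fintype]
  · refine Finset.sum_congr rfl fun s _ => ?_
    rw [Measure.real, Measure.map_apply (measurable_fairBits n) (measurableSet_singleton s)]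
    have : fairBits ⁻¹' {s} = {U : Fin n → I | fairBits U = s} := rfl
    rw [this, volume_fairBits_eq, ENNReal.toReal_ofReal (by positivity)]
  · have : IsProbabilityMeasure ((volume : Measure (Fin n → I)).map fairBits) :=
      Measure.isProbabilityMeasure_map (measurable_fairBits n).aemeasurable
    exact Integrable.of_finite

lemma integral_pow_changes {𝕜 : Type*} [RCLike 𝕜] (n : ℕ) (z : 𝕜) :
    ∫ U : Fin n → I, z ^ changes false (fairBits U) = ((1 + z) / 2) ^ n := by
  rw [integral_comp_fairBits fun s => z ^ changes false s, ← Finset.smul_sum, sum_pow_changes,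
    RCLike.real_smul_eq_coe_mul]
  push_cast
  rw [← mul_pow]
  congr 1
  ring

/-- The centred number of changes, a sum of `n` independent signs. -/
noncomputable def signSum {n : ℕ} (U : Fin n → I) : ℝ := 2 * changes false (fairBits U) - n

lemma measurable_signSum (n : ℕ) : Measurable fun U : Fin n → I => signSum U := by
  have : Measurable fun s : Fin n → Bool => (2 * changes false s - n : ℝ) := measurable_of_finite _
  exact this.comp (measurable_fairBits n)

lemma integrable_comp_signSum {n : ℕ} (f : ℝ → ℝ) :
    Integrable fun U : Fin n → I => f (signSum U) := by
  have h : Measurable fun s : Fin n → Bool => f (2 * changes false s - n) := measurable_of_finite _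
  obtain ⟨C, hC⟩ := (Set.finite_range fun s : Fin n → Bool =>
    ‖f (2 * changes false s - n)‖).bddAbove
  exact Integrable.of_bound (h.comp (measurable_fairBits n)).aestronglyMeasurable C
    (Eventually.of_forall fun U => hC ⟨fairBits U, rfl⟩)

lemma integral_exp_signSum (n : ℕ) (y : ℝ) :
    ∫ U : Fin n → I, Real.exp (y * signSum U) = Real.cosh y ^ n := by
  have h : ∀ U : Fin n → I, Real.exp (y * signSum U) =
      Real.exp (-y) ^ n * Real.exp (2 * y) ^ changes false (fairBits U) := by
    intro U
    rw [← Real.exp_nat_mul, ← Real.exp_nat_mul, ← Real.exp_add, signSum]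
    ring_nf
  simp only [h]
  rw [integral_const_mul, integral_pow_changes (𝕜 := ℝ), ← mul_pow, Real.cosh_eq]
  congr 1
  have : Real.exp (-y) * Real.exp (2 * y) = Real.exp y := by rw [← Real.exp_add]; ring_nf
  linear_combination this / 2

lemma integral_cexp_signSum (n : ℕ) (y : ℝ) :
    ∫ U : Fin n → I, Complex.exp (((y * signSum U : ℝ) : ℂ) * Complex.I) =
      ((Real.cos y : ℝ) : ℂ) ^ n := by
  have h : ∀ U : Fin n → I, Complex.exp (((y * signSum U : ℝ) : ℂ) * Complex.I) =
      Complex.exp (-y * Complex.I) ^ n *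
        Complex.exp (2 * y * Complex.I) ^ changes false (fairBits U) := by
    intro U
    rw [← Complex.exp_nat_mul, ← Complex.exp_nat_mul, ← Complex.exp_add, signSum]
    push_cast
    ring_nf
  simp only [h]
  rw [integral_const_mul, integral_pow_changes (𝕜 := ℂ), ← mul_pow, Complex.ofReal_cos,
    Complex.cos]
  congr 1
  have : Complex.exp (-y * Complex.I) * Complex.exp (2 * y * Complex.I) =
    Complex.exp (y * Complex.I) := by rw [← Complex.exp_add]; ring_nf
  linear_combination this / 2

/-! ### Exponential moments and characteristic function of the normalized maximum -/

lemma normMaxRuns_sort {n : ℕ} (U : Fin n → I) : normMaxRuns (Tuple.sort U) =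
    (√(n : ℝ))⁻¹ * ((levelRuns U midI : ℝ) - n / 4) + (√(n : ℝ))⁻¹ * excess U := by
  rw [normMaxRuns, excess]
  ring

/-- Runs are half the changes up to 1/2, and the changes are half of n + `signSum U`. The resulting
quarter is the source of the variance n/16. -/
lemma abs_levelRuns_sub_signSum {n : ℕ} (U : Fin n → I) :
    |((levelRuns U midI : ℝ) - n / 4) - signSum U / 4| ≤ 1 / 2 := by
  have h := abs_two_mul_runCount_sub_changes (fairBits U)
  have e : ((levelRuns U midI : ℝ) - n / 4) - signSum U / 4 =
      (2 * (runCount (fairBits U) : ℝ) - changes false (fairBits U)) / 2 := by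
    have e0 : levelRuns U midI = runCount (fairBits U) := rfl
    rw [signSum, e0]
    ring
  rw [e, abs_div, abs_two]
  linarith

lemma inv_sqrt_le_one {n : ℕ} (hn : 1 ≤ n) : (√(n : ℝ))⁻¹ ≤ 1 :=
  inv_le_one_of_one_le₀ (Real.one_le_sqrt.2 (by exact_mod_cast hn))

lemma integral_exp_abs_levelRuns_le {n : ℕ} (hn : 1 ≤ n) :
    ∫ U : Fin n → I, Real.exp |(√(n : ℝ))⁻¹ * ((levelRuns U midI : ℝ) - n / 4)| ≤
      2 * Real.exp 1 := by
  set c := (√(n : ℝ))⁻¹ with hc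
  have hc0 : 0 ≤ c := by positivity
  have hc1 : c ≤ 1 := inv_sqrt_le_one hn
  have hnc : (n : ℝ) * c ^ 2 = 1 := by
    rw [hc, inv_pow, Real.sq_sqrt (Nat.cast_nonneg n)]
    exact mul_inv_cancel₀ (by exact_mod_cast (by omega : n ≠ 0))
  have hpt : ∀ U : Fin n → I, Real.exp |c * ((levelRuns U midI : ℝ) - n / 4)| ≤
      Real.exp (1 / 2) * (Real.exp (c / 4 * signSum U) + Real.exp (-(c / 4) * signSum U)) := by
    intro U
    have h1 : |c * ((levelRuns U midI : ℝ) - n / 4)| ≤ 1 / 2 + |c / 4 * signSum U| := by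
      have := abs_levelRuns_sub_signSum U
      have e : c * ((levelRuns U midI : ℝ) - n / 4) =
        c * (((levelRuns U midI : ℝ) - n / 4) - signSum U / 4) + c / 4 * signSum U := by ring
      rw [e]
      refine (abs_add_le _ _).trans (add_le_add_left ?_ _)
      rw [abs_mul, abs_of_nonneg hc0]
      calc _ ≤ 1 * (1 / 2 : ℝ) := mul_le_mul hc1 this (abs_nonneg _) zero_le_one
        _ = _ := one_mul _
    refine (Real.exp_le_exp.2 h1).trans ?_
    rw [Real.exp_add, neg_mul]
    gcongr
    rcases abs_cases (c / 4 * signSum U) with h | h <;> rw [h.1] <;>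
      linarith [Real.exp_pos (c / 4 * signSum U), Real.exp_pos (-(c / 4 * signSum U))]
  have hi := fun y : ℝ => integrable_comp_signSum (n := n) fun x => Real.exp (y * x)
  refine (integral_mono_of_nonneg (Eventually.of_forall fun U => (Real.exp_pos _).le)
    (((hi (c / 4)).add (hi (-(c / 4)))).const_mul _) (Eventually.of_forall hpt)).trans ?_
  rw [integral_const_mul]
  simp only [Pi.add_apply]
  rw [integral_add (hi (c / 4)) (hi (-(c / 4))), integral_exp_signSum, integral_exp_signSum,
    Real.cosh_neg]
  have h2 : Real.cosh (c / 4) ^ n ≤ Real.exp (1 / 2) := by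
    -- The subgaussian bound cosh y ≤ e^(y²/2), with n c² = 1.
    calc Real.cosh (c / 4) ^ n ≤ Real.exp ((c / 4) ^ 2 / 2) ^ n :=
          pow_le_pow_left₀ (Real.cosh_pos _).le (Real.cosh_le_exp_half_sq _) n
      _ = Real.exp (1 / 32) := by
          rw [← Real.exp_nat_mul]
          congr 1
          linear_combination hnc / 32
      _ ≤ _ := Real.exp_le_exp.2 (by norm_num)
  have h3 : Real.exp 1 = Real.exp (1 / 2) * Real.exp (1 / 2) := by
    rw [← Real.exp_add]
    norm_num
  rw [h3]
  nlinarith [Real.exp_pos (1 / 2)]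

/-- Halving the exponent separates the middle level from the excess by e^((a+b)/2) ≤ (e^a + e^b)/2,
with no independence needed. The bound dominates every power of the normalized maximum uniformly in
n. -/
lemma exists_integral_exp_abs_normMaxRuns_le :
    ∃ C : ℝ, ∀ᶠ n : ℕ in atTop,
      ∫ U : Fin n → I, Real.exp (|normMaxRuns (Tuple.sort U)| / 2) ≤ C := by
  refine ⟨Real.exp 1 + Real.exp 1, ?_⟩
  filter_upwards [eventually_ge_atTop 8,
    tendsto_excessRate.eventually_le_const (by norm_num : (0 : ℝ) < 1)] with n hn hr
  set c := (√(n : ℝ))⁻¹ with hc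
  have hc0 : 0 ≤ c := by positivity
  have hpt : ∀ U : Fin n → I, Real.exp (|normMaxRuns (Tuple.sort U)| / 2) ≤
      Real.exp |c * ((levelRuns U midI : ℝ) - n / 4)| / 2 + Real.exp (c * excess U) / 2 := by
    intro U
    have h1 : |normMaxRuns (Tuple.sort U)| ≤
        |c * ((levelRuns U midI : ℝ) - n / 4)| + c * excess U := by
      rw [normMaxRuns_sort]
      refine (abs_add_le _ _).trans (le_of_eq ?_)
      rw [abs_of_nonneg (mul_nonneg hc0 (excess_nonneg U))]
    set a := |c * ((levelRuns U midI : ℝ) - n / 4)|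
    set b := c * excess U
    have h2 : Real.exp (|normMaxRuns (Tuple.sort U)| / 2) ≤ Real.exp (a / 2) * Real.exp (b / 2) := by
      rw [← Real.exp_add]
      exact Real.exp_le_exp.2 (by linarith)
    have h3 : ∀ y : ℝ, Real.exp y = Real.exp (y / 2) ^ 2 := by
      intro y
      rw [← Real.exp_nat_mul]
      push_cast
      ring_nf
    rw [h3 a, h3 b]
    nlinarith [sq_nonneg (Real.exp (a / 2) - Real.exp (b / 2))]
  have hi1 : Integrable fun U : Fin n → I =>
      Real.exp |c * ((levelRuns U midI : ℝ) - n / 4)| := by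
    have hm := measurable_levelRuns_midI n
    refine Integrable.of_bound ((Real.continuous_exp.comp continuous_abs).measurable.comp
      ((hm.sub_const (n / 4 : ℝ)).const_mul c)).aestronglyMeasurable (Real.exp (c * (n + n / 4)))
      (Eventually.of_forall fun U => ?_)
    rw [Real.norm_eq_abs, abs_of_pos (Real.exp_pos _), abs_mul, abs_of_nonneg hc0]
    have h1 : (levelRuns U midI : ℝ) ≤ n := by exact_mod_cast runCount_le _
    have h2 : (0 : ℝ) ≤ levelRuns U midI := Nat.cast_nonneg _
    have h3 : (0 : ℝ) ≤ n := Nat.cast_nonneg _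
    gcongr
    rw [abs_le]
    constructor <;> linarith
  have hi2 := integrable_comp_excess (n := n) (f := fun x => Real.exp (c * x)) (by fun_prop)
  refine (integral_mono_of_nonneg (Eventually.of_forall fun U => (Real.exp_pos _).le)
    ((hi1.div_const 2).add (hi2.div_const 2)) (Eventually.of_forall hpt)).trans ?_
  simp only [Pi.add_apply]
  rw [integral_add (hi1.div_const 2) (hi2.div_const 2), integral_div, integral_div]
  have h1 := integral_exp_abs_levelRuns_le (n := n) (by omega)
  have h2 := (integral_exp_excess_le_two_mul hn).trans
    (mul_le_mul_of_nonneg_left (Real.exp_le_exp.2 hr) zero_le_two)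
  rw [← hc] at h1 h2
  linarith

lemma tendsto_cos_div_sqrt_pow (t : ℝ) :
    Tendsto (fun n : ℕ => Real.cos (t * (√(n : ℝ))⁻¹ / 4) ^ n) atTop
      (𝓝 (Real.exp (-(t ^ 2 / 32)))) := by
  have h0 : Tendsto (fun n : ℕ => t * (√(n : ℝ))⁻¹ / 8) atTop (𝓝 0) := by
    have : Tendsto (fun n : ℕ => (√(n : ℝ))⁻¹) atTop (𝓝 0) :=
      (Real.tendsto_sqrt_atTop.comp tendsto_natCast_atTop_atTop).inv_tendsto_atTop
    simpa using (this.const_mul t).div_const 8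
  -- By the half-angle formula, n (cos (t c / 4) - 1) equals -(t²/32) sinc² (t c / 8) exactly, so
  -- continuity of sinc at 0 replaces a Taylor expansion and t = 0 needs no separate treatment.
  have hs : Tendsto (fun n : ℕ => Real.sinc (t * (√(n : ℝ))⁻¹ / 8)) atTop (𝓝 1) := by
    simpa [Function.comp_def] using (Real.continuous_sinc.tendsto 0).comp h0
  have hg : Tendsto (fun n : ℕ => (n : ℝ) * (Real.cos (t * (√(n : ℝ))⁻¹ / 4) - 1)) atTop
      (𝓝 (-(t ^ 2 / 32))) := by
    have := (hs.pow 2).const_mul (-(t ^ 2 / 32))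
    simp only [one_pow, mul_one] at this
    refine this.congr' ?_
    filter_upwards [eventually_ge_atTop 1] with n hn
    set c := (√(n : ℝ))⁻¹ with hc
    have hnc : (n : ℝ) * c ^ 2 = 1 := by
      rw [hc, inv_pow, Real.sq_sqrt (Nat.cast_nonneg n)]
      exact mul_inv_cancel₀ (by exact_mod_cast (by omega : n ≠ 0))
    have hx : Real.sin (t * c / 8) = t * c / 8 * Real.sinc (t * c / 8) := by
      by_cases h : t * c / 8 = 0
      · rw [h]
        simp
      · rw [Real.sinc_of_ne_zero h, mul_div_cancel₀ _ h]
    have h2 : Real.cos (t * c / 4) = 1 - 2 * Real.sin (t * c / 8) ^ 2 := by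
      rw [show t * c / 4 = 2 * (t * c / 8) by ring, Real.cos_two_mul, Real.cos_sq']
      ring
    rw [h2, hx]
    linear_combination (-(t ^ 2 / 32) * Real.sinc (t * c / 8) ^ 2) * (-hnc)
  refine (Real.tendsto_one_add_pow_exp_of_tendsto hg).congr fun n => ?_
  simp

/-- Since y ↦ e^(iy) is 1-Lipschitz, replacing the normalized maximum by c/4 times `signSum U` costs
at most |t| times their mean distance, which tends to 0. -/
lemma tendsto_integral_cexp_normMaxRuns (t : ℝ) :
    Tendsto (fun n : ℕ => ∫ U : Fin n → I,
      Complex.exp (((t * normMaxRuns (Tuple.sort U) : ℝ) : ℂ) * Complex.I)) atTop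
      (𝓝 ((Real.exp (-(t ^ 2 / 32)) : ℝ) : ℂ)) := by
  have h1 : Tendsto (fun n : ℕ => ((Real.cos (t * (√(n : ℝ))⁻¹ / 4) : ℝ) : ℂ) ^ n) atTop
      (𝓝 ((Real.exp (-(t ^ 2 / 32)) : ℝ) : ℂ)) :=
    ((Complex.continuous_ofReal.tendsto _).comp (tendsto_cos_div_sqrt_pow t)).congr
      fun n => by simp
  have hb : Tendsto (fun n : ℕ => |t| * ((√(n : ℝ))⁻¹ / 2 + excessRate n)) atTop (𝓝 0) := by
    have : Tendsto (fun n : ℕ => (√(n : ℝ))⁻¹) atTop (𝓝 0) :=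
      (Real.tendsto_sqrt_atTop.comp tendsto_natCast_atTop_atTop).inv_tendsto_atTop
    simpa using ((this.div_const 2).add tendsto_excessRate).const_mul |t|
  suffices h : Tendsto (fun n : ℕ => (∫ U : Fin n → I,
      Complex.exp (((t * normMaxRuns (Tuple.sort U) : ℝ) : ℂ) * Complex.I)) -
      ((Real.cos (t * (√(n : ℝ))⁻¹ / 4) : ℝ) : ℂ) ^ n) atTop (𝓝 0) by
    simpa using h.add h1
  refine squeeze_zero_norm' ?_ hb
  filter_upwards [eventually_ge_atTop 8] with n hn
  set c := (√(n : ℝ))⁻¹ with hc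
  have hc0 : 0 ≤ c := by positivity
  have hY : Measurable fun U : Fin n → I => normMaxRuns (Tuple.sort U) :=
    (isUniformPerm_sort n).measurable_comp normMaxRuns
  have hexp : ∀ {g : (Fin n → I) → ℝ}, Measurable g →
      Integrable fun U : Fin n → I => Complex.exp ((g U : ℂ) * Complex.I) := by
    intro g hg
    refine Integrable.of_bound (by fun_prop) 1 (Eventually.of_forall fun U => ?_)
    rw [Complex.norm_exp_ofReal_mul_I]
  have hS := measurable_signSum n
  rw [← integral_cexp_signSum, ← integral_sub (hexp (hY.const_mul t))
    (hexp (hS.const_mul (t * c / 4)))]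
  refine (norm_integral_le_integral_norm _).trans ?_
  have hi := integrable_comp_excess (n := n) (f := fun x => c * x) (by fun_prop)
  have hpt : ∀ U : Fin n → I,
      ‖Complex.exp (((t * normMaxRuns (Tuple.sort U) : ℝ) : ℂ) * Complex.I) -
        Complex.exp (((t * c / 4 * signSum U : ℝ) : ℂ) * Complex.I)‖ ≤
      |t| * (c / 2 + c * excess U) := by
    intro U
    set a := t * normMaxRuns (Tuple.sort U) with ha
    set b := t * c / 4 * signSum U with hb
    have e : Complex.exp ((a : ℂ) * Complex.I) - Complex.exp ((b : ℂ) * Complex.I) =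
        Complex.exp ((b : ℂ) * Complex.I) *
          (Complex.exp (Complex.I * ((a - b : ℝ) : ℂ)) - 1) := by
      rw [mul_sub, ← Complex.exp_add, mul_one]
      push_cast
      ring_nf
    rw [e, norm_mul, Complex.norm_exp_ofReal_mul_I, one_mul]
    refine Real.norm_exp_I_mul_ofReal_sub_one_le.trans ?_
    have e2 : a - b = t * (c * (((levelRuns U midI : ℝ) - n / 4) - signSum U / 4) +
        c * excess U) := by
      rw [ha, hb, normMaxRuns_sort]
      ring
    rw [e2, Real.norm_eq_abs, abs_mul]
    gcongr
    refine (abs_add_le _ _).trans ?_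
    rw [abs_of_nonneg (mul_nonneg hc0 (excess_nonneg U)), abs_mul, abs_of_nonneg hc0]
    have := mul_le_mul_of_nonneg_left (abs_levelRuns_sub_signSum U) hc0
    linarith
  refine (integral_mono_of_nonneg (Eventually.of_forall fun U => norm_nonneg _)
    (((integrable_const (c / 2)).add hi).const_mul |t|) (Eventually.of_forall hpt)).trans ?_
  rw [integral_const_mul]
  simp only [Pi.add_apply]
  rw [integral_add (integrable_const (c / 2)) hi]
  simp only [integral_const, probReal_univ, smul_eq_mul, one_mul]
  gcongr
  exact integral_excess_le hn

end IndependentUniforms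

/-! ### From weak convergence to convergence of moments -/

/-- Weak convergence of probability measures on the line with bounded second moments of `f`
gives convergence of the expectations of the continuous function `f`. -/
lemma tendsto_integral_of_integral_sq_le {μ : ℕ → ProbabilityMeasure ℝ} {ν : ProbabilityMeasure ℝ}
    (h : Tendsto μ atTop (𝓝 ν)) {f : ℝ → ℝ} (hf : Continuous f) {C : ℝ}
    (hμ : ∀ᶠ n in atTop, Integrable (fun x => f x ^ 2) (μ n : Measure ℝ) ∧
      ∫ x, f x ^ 2 ∂(μ n : Measure ℝ) ≤ C)
    (hν : Integrable (fun x => f x ^ 2) (ν : Measure ℝ)) :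
    Tendsto (fun n => ∫ x, f x ∂(μ n : Measure ℝ)) atTop (𝓝 (∫ x, f x ∂(ν : Measure ℝ))) := by
  set C' := max (max C (∫ x, f x ^ 2 ∂(ν : Measure ℝ))) 0 with hC'
  have hC'0 : 0 ≤ C' := le_max_right _ _
  -- Truncating at ±K changes a value y by at most y²/K, so the second moment controls the error
  -- uniformly in the measure.
  have key : ∀ (ρ : ProbabilityMeasure ℝ) (K : ℝ), 0 < K →
      Integrable (fun x => f x ^ 2) (ρ : Measure ℝ) → ∫ x, f x ^ 2 ∂(ρ : Measure ℝ) ≤ C' →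
      |∫ x, f x ∂(ρ : Measure ℝ) - ∫ x, max (-K) (min K (f x)) ∂(ρ : Measure ℝ)| ≤ C' / K := by
    intro ρ K hK hi hle
    have hfi : Integrable f (ρ : Measure ℝ) :=
      ((memLp_two_iff_integrable_sq hf.aestronglyMeasurable).2 hi).integrable one_le_two
    have hgi : Integrable (fun x => max (-K) (min K (f x))) (ρ : Measure ℝ) := by
      refine Integrable.of_bound (by fun_prop) K (Eventually.of_forall fun x => ?_)
      rw [Real.norm_eq_abs, abs_le]
      exact ⟨le_max_left _ _, max_le (by linarith) (min_le_left _ _)⟩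
    rw [← integral_sub hfi hgi]
    refine abs_integral_le_integral_abs.trans ?_
    refine (integral_mono_of_nonneg (Eventually.of_forall fun x => abs_nonneg _)
      (hi.div_const K) (Eventually.of_forall fun x => ?_)).trans ?_
    · change |f x - max (-K) (min K (f x))| ≤ f x ^ 2 / K
      rw [le_div_iff₀ hK]
      rcases le_total (f x) (-K) with h1 | h1
      · rw [min_eq_right (by linarith), max_eq_left h1, abs_of_nonpos (by linarith)]
        nlinarith
      rcases le_total K (f x) with h2 | h2
      · rw [min_eq_left h2, max_eq_right (by linarith), abs_of_nonneg (by linarith)]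
        nlinarith
      · rw [min_eq_right h2, max_eq_right h1, sub_self, abs_zero, zero_mul]
        positivity
    · rw [integral_div]
      gcongr
  rw [Metric.tendsto_nhds]
  intro ε hε
  -- The summand 1 keeps `K` positive when `C'` is 0 and makes the bound ε/3 strict.
  set K := 3 * C' / ε + 1 with hK
  have hK0 : 0 < K := by positivity
  have hKε : C' / K < ε / 3 := by
    rw [div_lt_iff₀ hK0, hK]
    field_simp
    linarith
  let g : BoundedContinuousFunction ℝ ℝ := BoundedContinuousFunction.ofNormedAddCommGroup
    (fun x => max (-K) (min K (f x))) (by fun_prop) K (fun x => by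
      rw [Real.norm_eq_abs, abs_le]
      exact ⟨le_max_left _ _, max_le (by linarith) (min_le_left _ _)⟩)
  have hg := (ProbabilityMeasure.tendsto_iff_forall_integral_tendsto.1 h) g
  rw [Metric.tendsto_nhds] at hg
  filter_upwards [hμ, hg (ε / 3) (by positivity)] with n hn hgn
  have h1 := key (μ n) K hK0 hn.1 (hn.2.trans ((le_max_left _ _).trans (le_max_left _ _)))
  have h2 := key ν K hK0 hν ((le_max_right _ _).trans (le_max_left _ _))
  rw [Real.dist_eq] at hgn ⊢
  change |∫ x, max (-K) (min K (f x)) ∂(μ n : Measure ℝ) -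
    ∫ x, max (-K) (min K (f x)) ∂(ν : Measure ℝ)| < ε / 3 at hgn
  rw [abs_le] at h1 h2
  rw [abs_lt] at hgn ⊢
  constructor <;> linarith [h1.1, h1.2, h2.1, h2.2, hgn.1, hgn.2]

lemma pow_abs_le_exp (k : ℕ) (x : ℝ) :
    |x| ^ k ≤ 2 ^ k * k.factorial * Real.exp (|x| / 2) := by
  have h := Real.pow_div_factorial_le_exp (x := |x| / 2) (by positivity) k
  rw [div_le_iff₀ (by positivity), div_pow, div_le_iff₀ (by positivity)] at h
  linarith

lemma exists_sq_pow_le_exp (r : ℕ) : ∃ C : ℝ, ∀ x : ℝ, (x ^ r) ^ 2 ≤ C * Real.exp (|x| / 2) := by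
  refine ⟨_, fun x => le_trans (le_of_eq ?_) (pow_abs_le_exp (r * 2) x)⟩
  rw [pow_mul, ← abs_pow, sq_abs]

lemma exists_sq_rpow_abs_le_exp {r : ℝ} (hr : 0 < r) :
    ∃ C : ℝ, ∀ x : ℝ, (|x| ^ r) ^ 2 ≤ C * Real.exp (|x| / 2) := by
  set k := ⌈r * 2⌉₊ with hk
  refine ⟨1 + 2 ^ k * k.factorial, fun x => ?_⟩
  have h1 : (1 : ℝ) ≤ Real.exp (|x| / 2) := Real.one_le_exp (by positivity)
  have h2 := pow_abs_le_exp k x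
  have h3 : (|x| ^ r) ^ 2 ≤ 1 + |x| ^ k := by
    rw [← Real.rpow_natCast (|x| ^ r), ← Real.rpow_mul (abs_nonneg x)]
    rcases le_total |x| 1 with hx | hx
    · have := Real.rpow_le_one (abs_nonneg x) hx (by positivity : 0 ≤ r * (2 : ℕ))
      have : 0 ≤ |x| ^ k := by positivity
      linarith
    · have : |x| ^ (r * (2 : ℕ)) ≤ |x| ^ (k : ℝ) :=
        Real.rpow_le_rpow_of_exponent_le hx (by push_cast; exact Nat.le_ceil _)
      rw [Real.rpow_natCast] at this
      linarith
  nlinarith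

lemma integrable_exp_abs_div_two_gaussianReal (m : ℝ) (v : ℝ≥0) :
    Integrable (fun x : ℝ => Real.exp (|x| / 2)) (gaussianReal m v) := by
  refine ((integrable_exp_mul_gaussianReal (μ := m) (v := v) (1 / 2)).add
    (integrable_exp_mul_gaussianReal (μ := m) (v := v) (-(1 / 2)))).mono' (by fun_prop)
    (Eventually.of_forall fun x => ?_)
  rw [Real.norm_eq_abs, abs_of_pos (Real.exp_pos _), Pi.add_apply]
  have h1 := Real.exp_pos (1 / 2 * x)
  have h2 := Real.exp_pos (-(1 / 2) * x)
  rcases abs_cases x with h | h <;> rw [h.1]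
  · rw [show x / 2 = 1 / 2 * x by ring]
    linarith
  · rw [show -x / 2 = -(1 / 2) * x by ring]
    linarith

lemma integral_sq_gaussianReal_zero (v : ℝ≥0) : ∫ x : ℝ, x ^ 2 ∂(gaussianReal 0 v) = v := by
  have h1 := variance_eq_sub (memLp_id_gaussianReal (μ := 0) (v := v) 2)
  rw [variance_id_gaussianReal] at h1
  simpa using h1.symm

/-! ### Transfer to an arbitrary uniform permutation -/

section Transfer

variable {Ω : ℕ → Type*} [∀ n, MeasurableSpace (Ω n)] {P : ∀ n, Measure (Ω n)}
  {σ : ∀ n, Ω n → Equiv.Perm (Fin n)}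

lemma IsUniformPerm.integrable_comp {Ω' : Type*} [MeasurableSpace Ω'] {n : ℕ}
    {Q : Measure Ω'} [IsProbabilityMeasure Q] {τ : Ω' → Equiv.Perm (Fin n)}
    (h : IsUniformPerm τ Q) (g : Equiv.Perm (Fin n) → ℝ) : Integrable (fun ω => g (τ ω)) Q := by
  obtain ⟨C, hC⟩ := (Set.finite_range fun π => ‖g π‖).bddAbove
  exact Integrable.of_bound (h.measurable_comp g).aestronglyMeasurable C
    (Eventually.of_forall fun ω => hC ⟨τ ω, rfl⟩)

/-- The law of the normalized maximum. -/
noncomputable def normMaxRunsLaw (n : ℕ) : ProbabilityMeasure ℝ :=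
  ⟨(volume : Measure (Fin n → unitInterval)).map fun U => normMaxRuns (Tuple.sort U),
    Measure.isProbabilityMeasure_map
      ((isUniformPerm_sort n).measurable_comp normMaxRuns).aemeasurable⟩

lemma IsUniformPerm.map_normMaxRuns {Ω' : Type*} [MeasurableSpace Ω'] {n : ℕ}
    {Q : Measure Ω'} {τ : Ω' → Equiv.Perm (Fin n)} (h : IsUniformPerm τ Q) :
    Q.map (fun ω => normMaxRuns (τ ω)) = normMaxRunsLaw n := by
  rw [h.map_comp normMaxRuns, ← (isUniformPerm_sort n).map_comp normMaxRuns]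
  rfl

lemma tendsto_normMaxRunsLaw :
    Tendsto normMaxRunsLaw atTop (𝓝 ⟨gaussianReal 0 (1 / 16), inferInstance⟩) := by
  refine ProbabilityMeasure.tendsto_of_tendsto_charFun fun t => ?_
  have h1 : charFun (gaussianReal 0 (1 / 16)) t = ((Real.exp (-(t ^ 2 / 32)) : ℝ) : ℂ) := by
    rw [charFun_gaussianReal]
    push_cast
    congr 1
    ring
  rw [ProbabilityMeasure.coe_mk, h1]
  refine (tendsto_integral_cexp_normMaxRuns t).congr fun n => ?_
  rw [charFun_apply_real, normMaxRunsLaw, ProbabilityMeasure.coe_mk, integral_map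
    ((isUniformPerm_sort n).measurable_comp normMaxRuns).aemeasurable (by fun_prop)]
  simp only [Complex.ofReal_mul]

lemma integral_normMaxRunsLaw (hσ : ∀ n, IsUniformPerm (σ n) (P n)) {f : ℝ → ℝ}
    (hf : Continuous f) (n : ℕ) :
    ∫ ω, f (normMaxRuns (σ n ω)) ∂(P n) = ∫ x, f x ∂(normMaxRunsLaw n : Measure ℝ) := by
  rw [← (hσ n).map_normMaxRuns, integral_map ((hσ n).measurable_comp normMaxRuns).aemeasurable
    hf.aestronglyMeasurable]

lemma integrable_normMaxRunsLaw {f : ℝ → ℝ} (hf : Continuous f) (n : ℕ) :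
    Integrable f (normMaxRunsLaw n : Measure ℝ) := by
  rw [normMaxRunsLaw, ProbabilityMeasure.coe_mk, integrable_map_measure hf.aestronglyMeasurable
    ((isUniformPerm_sort n).measurable_comp normMaxRuns).aemeasurable]
  exact (isUniformPerm_sort n).integrable_comp fun π => f (normMaxRuns π)

/-- Expectations of continuous functions of moderate exponential growth converge. -/
lemma tendsto_integral_normMaxRuns (hσ : ∀ n, IsUniformPerm (σ n) (P n)) {f : ℝ → ℝ}
    (hf : Continuous f) (hC : ∃ C : ℝ, ∀ x : ℝ, f x ^ 2 ≤ C * Real.exp (|x| / 2)) :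
    Integrable f (gaussianReal 0 (1 / 16)) ∧
      Tendsto (fun n => ∫ ω, f (normMaxRuns (σ n ω)) ∂(P n)) atTop
        (𝓝 (∫ x, f x ∂(gaussianReal 0 (1 / 16)))) := by
  obtain ⟨C, hC⟩ := hC
  obtain ⟨B, hB⟩ := exists_integral_exp_abs_normMaxRuns_le
  have hC0 : 0 ≤ C := by
    have := (sq_nonneg (f 0)).trans (hC 0)
    simpa using this
  have hν : Integrable (fun x => f x ^ 2) (gaussianReal 0 (1 / 16)) := by
    refine ((integrable_exp_abs_div_two_gaussianReal 0 (1 / 16)).const_mul C).mono'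
      (by fun_prop) (Eventually.of_forall fun x => ?_)
    rw [Real.norm_eq_abs, abs_of_nonneg (sq_nonneg _)]
    exact hC x
  refine ⟨((memLp_two_iff_integrable_sq hf.aestronglyMeasurable).2 hν).integrable one_le_two, ?_⟩
  simp only [integral_normMaxRunsLaw hσ hf]
  refine tendsto_integral_of_integral_sq_le (C := C * B) tendsto_normMaxRunsLaw hf ?_ hν
  filter_upwards [hB] with n hn
  refine ⟨integrable_normMaxRunsLaw (by fun_prop) n, ?_⟩
  have he : Continuous fun x : ℝ => Real.exp (|x| / 2) := by fun_prop
  calc ∫ x, f x ^ 2 ∂(normMaxRunsLaw n : Measure ℝ)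
      ≤ ∫ x, C * Real.exp (|x| / 2) ∂(normMaxRunsLaw n : Measure ℝ) :=
        integral_mono (integrable_normMaxRunsLaw (by fun_prop) n)
          (integrable_normMaxRunsLaw (by fun_prop) n) hC
    _ ≤ C * B := by
        rw [integral_const_mul]
        refine mul_le_mul_of_nonneg_left (le_trans (le_of_eq ?_) hn) hC0
        rw [normMaxRunsLaw, ProbabilityMeasure.coe_mk, integral_map
          ((isUniformPerm_sort n).measurable_comp normMaxRuns).aemeasurable
          he.aestronglyMeasurable]

end Transfer

/-! ### Mean, variance and the limit theorem -/

lemma maxRuns_eq_sqrt_mul_normMaxRuns {n : ℕ} (π : Equiv.Perm (Fin n)) :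
    (maxRuns π : ℝ) = √(n : ℝ) * normMaxRuns π + n / 4 := by
  rcases Nat.eq_zero_or_pos n with rfl | hn
  -- For n = 0 the normalization is degenerate, but both sides vanish.
  · have := maxRuns_le π
    simp [Nat.le_zero.1 this]
  · have : √(n : ℝ) ≠ 0 := (Real.sqrt_pos.2 (by exact_mod_cast hn)).ne'
    rw [normMaxRuns, mul_inv_cancel_left₀ this]
    ring

theorem theorem1 {Ω : ℕ → Type*} [∀ n, MeasurableSpace (Ω n)] (P : ∀ n, Measure (Ω n))
    [∀ n, IsProbabilityMeasure (P n)] (σ : ∀ n, Ω n → Equiv.Perm (Fin n))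
    (hσ : ∀ n, IsUniformPerm (σ n) (P n)) :
    -- convergence in distribution to `N(0, 1/16)`
    TendstoInDistribution (fun n ω => normMaxRuns (σ n ω)) atTop (id : ℝ → ℝ) P
      (gaussianReal 0 (1 / 16)) ∧
    -- all moments exist and converge
    (∀ r : ℕ, (∀ n, Integrable (fun ω => normMaxRuns (σ n ω) ^ r) (P n)) ∧
      Integrable (fun x : ℝ => x ^ r) (gaussianReal 0 (1 / 16)) ∧
      Tendsto (fun n => ∫ ω, normMaxRuns (σ n ω) ^ r ∂(P n)) atTop
        (𝓝 (∫ x, x ^ r ∂(gaussianReal 0 (1 / 16))))) ∧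
    -- all absolute moments exist and converge
    (∀ r : ℝ, 0 < r → (∀ n, Integrable (fun ω => |normMaxRuns (σ n ω)| ^ r) (P n)) ∧
      Integrable (fun x : ℝ => |x| ^ r) (gaussianReal 0 (1 / 16)) ∧
      Tendsto (fun n => ∫ ω, |normMaxRuns (σ n ω)| ^ r ∂(P n)) atTop
        (𝓝 (∫ x, |x| ^ r ∂(gaussianReal 0 (1 / 16))))) ∧
    -- mean and variance of the maximum
    (∀ n, MemLp (fun ω => (maxRuns (σ n ω) : ℝ)) 2 (P n)) ∧
    (fun n : ℕ => (∫ ω, (maxRuns (σ n ω) : ℝ) ∂(P n)) - (n : ℝ) / 4)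
      =o[atTop] (fun n : ℕ => √(n : ℝ)) ∧
    (fun n : ℕ => variance (fun ω => (maxRuns (σ n ω) : ℝ)) (P n) - (n : ℝ) / 16)
      =o[atTop] (fun n : ℕ => (n : ℝ)) ∧
    -- the constant `γ = lim E X*_n / n` exists and equals `1/4`
    Tendsto (fun n : ℕ => (∫ ω, (maxRuns (σ n ω) : ℝ) ∂(P n)) / (n : ℝ)) atTop (𝓝 (1 / 4)) := by
  have hmom : ∀ r : ℕ, _ := fun r => tendsto_integral_normMaxRuns hσ (f := fun x => x ^ r)
    (by fun_prop) (exists_sq_pow_le_exp r)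
  have hint : ∀ (g : ℝ → ℝ) (n : ℕ), Integrable (fun ω => g (normMaxRuns (σ n ω))) (P n) :=
    fun g n => (hσ n).integrable_comp fun π => g (normMaxRuns π)
  have hY1 : Tendsto (fun n => ∫ ω, normMaxRuns (σ n ω) ∂(P n)) atTop (𝓝 0) := by
    have := (hmom 1).2
    simp only [pow_one, integral_id_gaussianReal] at this
    exact this
  have hY2 : Tendsto (fun n => ∫ ω, normMaxRuns (σ n ω) ^ 2 ∂(P n)) atTop (𝓝 (1 / 16)) := by
    have := (hmom 2).2
    rw [integral_sq_gaussianReal_zero] at this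
    simpa using this
  have hmean : ∀ n, ∫ ω, (maxRuns (σ n ω) : ℝ) ∂(P n) =
      √(n : ℝ) * ∫ ω, normMaxRuns (σ n ω) ∂(P n) + n / 4 := by
    intro n
    simp only [maxRuns_eq_sqrt_mul_normMaxRuns]
    rw [integral_add ((hint (fun x => x) n).const_mul _) (integrable_const _), integral_const_mul]
    simp
  refine ⟨⟨fun n => ((hσ n).measurable_comp normMaxRuns).aemeasurable, by fun_prop, ?_⟩,
    fun r => ⟨hint (fun x => x ^ r), (hmom r).1, (hmom r).2⟩, fun r hr => ?_, fun n => ?_, ?_, ?_, ?_⟩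
  · have h := tendsto_normMaxRunsLaw
    have hlim : (⟨(gaussianReal 0 (1 / 16)).map id, Measure.isProbabilityMeasure_map
        aemeasurable_id⟩ : ProbabilityMeasure ℝ) = ⟨gaussianReal 0 (1 / 16), inferInstance⟩ :=
      Subtype.ext Measure.map_id
    rw [hlim]
    exact h.congr fun n => Subtype.ext (hσ n).map_normMaxRuns.symm
  · have := tendsto_integral_normMaxRuns hσ (f := fun x => |x| ^ r)
      (continuous_abs.rpow_const fun _ => Or.inr hr.le) (exists_sq_rpow_abs_le_exp hr)
    exact ⟨hint (fun x => |x| ^ r), this.1, this.2⟩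
  · rw [memLp_two_iff_integrable_sq
      ((hσ n).measurable_comp fun π => (maxRuns π : ℝ)).aestronglyMeasurable]
    exact (hσ n).integrable_comp fun π => (maxRuns π : ℝ) ^ 2
  · simp only [hmean, add_sub_cancel_right]
    simpa using (isBigO_refl (fun n : ℕ => √(n : ℝ)) atTop).mul_isLittleO
      ((isLittleO_one_iff ℝ).2 hY1)
  -- The variance of the maximum is n times that of the normalized maximum, which tends to 1/16 by
  -- the moments of orders 1 and 2.
  · have hvar : ∀ n : ℕ, variance (fun ω => (maxRuns (σ n ω) : ℝ)) (P n) - (n : ℝ) / 16 =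
        n * ((∫ ω, normMaxRuns (σ n ω) ^ 2 ∂(P n)) - (∫ ω, normMaxRuns (σ n ω) ∂(P n)) ^ 2 -
          1 / 16) := by
      intro n
      have hm : AEStronglyMeasurable (fun ω => normMaxRuns (σ n ω)) (P n) :=
        ((hσ n).measurable_comp normMaxRuns).aestronglyMeasurable
      simp only [maxRuns_eq_sqrt_mul_normMaxRuns]
      rw [variance_add_const (hm.const_mul _), variance_const_mul, Real.sq_sqrt (Nat.cast_nonneg n),
        variance_eq_sub ((memLp_two_iff_integrable_sq hm).2 (hint (fun x => x ^ 2) n))]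
      simp only [Pi.pow_apply]
      ring
    simp only [hvar]
    have h0 := (hY2.sub (hY1.pow 2)).sub_const (1 / 16)
    norm_num at h0
    simpa using (isBigO_refl (fun n : ℕ => (n : ℝ)) atTop).mul_isLittleO
      ((isLittleO_one_iff ℝ).2 h0)
  · have h1 : Tendsto (fun n : ℕ => (√(n : ℝ))⁻¹) atTop (𝓝 0) :=
      (Real.tendsto_sqrt_atTop.comp tendsto_natCast_atTop_atTop).inv_tendsto_atTop
    have h2 := (h1.mul hY1).add_const (1 / 4)
    simp only [mul_zero, zero_add] at h2
    refine h2.congr' ?_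
    filter_upwards [eventually_ge_atTop 1] with n hn
    have hn0 : (n : ℝ) ≠ 0 := by exact_mod_cast (by omega : n ≠ 0)
    have hs : √(n : ℝ) * √(n : ℝ) = n := Real.mul_self_sqrt (Nat.cast_nonneg n)
    have hs0 : √(n : ℝ) ≠ 0 := (Real.sqrt_pos.2 (by exact_mod_cast hn)).ne'
    rw [hmean, add_div, inv_mul_eq_div]
    congr 1
    · rw [div_eq_div_iff hs0 hn0]
      linear_combination -(∫ ω, normMaxRuns (σ n ω) ∂(P n)) * hs
    · field_simp
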